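/- Let $k$ be an algebraically closed field, $r\ge 2$, and $R=k[x_0,\dots,x_r]$ with the standard grading. Let $X_1,X_2\subset\mathbb P^r$ be complete intersection schemes of codimension $2$ without common components, such that $X_1\cup X_2$ is arithmetically Cohen--Macaulay (that is, $R/(I_{X_1}\cap I_{X_2})$ is Cohen--Macaulay). Let $I_{X_1}=(f_1,g_1)$ and $I_{X_2}=(f_2,g_2)$ with $f_i,g_i$ forms of degrees $\deg f_i=d_i$, $\deg g_i=e_i$. Suppose that $f_2\in(f_1,g_1,g_2)$, say $f_2=a_1f_1+b_1g_1+b_2g_2$ with $a_1,b_1,b_2\in R$. Then: 1. $I_{X_1}\cap I_{X_2}=(f_2-b_2g_2,\; g_1g_2,\; f_1g_2)$. 2. The matrix $$M=\begin{pmatrix}-g_2&0\\ b_1&f_1\\ a_1&-g_1\end{pmatrix}$$ is a Hilbert--Burch matrix of $I_{X_1}\cap I_{X_2}$: the ideal is generated by the $2\times2$ minors of $M$, and $0\to R^2\xrightarrow{M}R^3\to I_{X_1}\cap I_{X_2}\to0$, with second map given by the signed $2\times 2$ minors of $M$, is exact. 3. If $a_1,b_1,b_2$ are chosen homogeneous of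 degrees $d_2-d_1$, $d_2-e_1$, $d_2-e_2$ respectively (a form of negative degree being $0$), then $$0\to R(-(d_2+e_2))\oplus R(-(d_1+e_1+e_2))\xrightarrow{M}R(-d_2)\oplus R(-(e_1+e_2))\oplus R(-(d_1+e_2))\to I_{X_1}\cap I_{X_2}\to 0,$$ with second map given by $(f_2-b_2g_2,\;g_1g_2,\;f_1g_2)$, is a graded free resolution of $I_{X_1}\cap I_{X_2}$. It is minimal if and only if neither $a_1$ nor $b_1$ is a nonzero constant. 4. The rings $R/(I_{X_1}\cap I_{X_2})$, $R/I_{X_1}$, $R/I_{X_2}$ have Artinian reductions (Artinian quotients by a regular sequence of linear forms), and for any Artinian reductions $A$, $A_1$, $A_2$ of these rings, the Hilbert functions satisfy $$H_A(t)=H_{A_1}(t-e_2)+H_{A_2}(t)\qquad\text{for all } t\in\mathbb Z.$$ -/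

import Mathlib

open MvPolynomial

noncomputable section

namespace UnionCI

variable {k : Type*} [Field k] {r : ℕ}

/-- The homogeneous part of degree `t` of `R = k[x₀, …, x_r]`, for an arbitrary integer `t`
(it is zero for negative `t`). -/
def piece (k : Type*) [Field k] (r : ℕ) (t : ℤ) : Submodule k (MvPolynomial (Fin (r + 1)) k) :=
  if 0 ≤ t then homogeneousSubmodule (Fin (r + 1)) k t.toNat else ⊥

/-- The ideal `(x₀, …, x_r)`. -/
def irrelevant (k : Type*) [Field k] (r : ℕ) : Ideal (MvPolynomial (Fin (r + 1)) k) :=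
  Ideal.span (Set.range X)

/-- `R / I` is Cohen-Macaulay: there is an `R / I`-regular sequence of forms of positive degree
whose length is the Krull dimension of `R / I`. -/
def IsACM (I : Ideal (MvPolynomial (Fin (r + 1)) k)) : Prop :=
  ∃ L : List (MvPolynomial (Fin (r + 1)) k),
    (∀ p ∈ L, ∃ n : ℕ, 0 < n ∧ p.IsHomogeneous n) ∧
    RingTheory.Sequence.IsRegular (MvPolynomial (Fin (r + 1)) k ⧸ I) L ∧
    ((L.length : ℕ) : WithBot ℕ∞) = ringKrullDim (MvPolynomial (Fin (r + 1)) k ⧸ I)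

/-- The schemes defined by `I` and `J` have no irreducible component in common. -/
def NoCommonComponents (I J : Ideal (MvPolynomial (Fin (r + 1)) k)) : Prop :=
  Disjoint I.minimalPrimes J.minimalPrimes

/-- `R / J` is an Artinian reduction of `R / I`: the ideal `J` is generated by `I` together with
linear forms that are a regular sequence on `R / I`, and `R / J` is Artinian. -/
def IsArtinianReduction (I J : Ideal (MvPolynomial (Fin (r + 1)) k)) : Prop :=
  ∃ L : List (MvPolynomial (Fin (r + 1)) k),
    (∀ p ∈ L, p.IsHomogeneous 1) ∧
    RingTheory.Sequence.IsRegular (MvPolynomial (Fin (r + 1)) k ⧸ I) L ∧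
    J = I ⊔ Ideal.ofList L ∧
    IsArtinianRing (MvPolynomial (Fin (r + 1)) k ⧸ J)

/-- The Hilbert function of `R / J`: the dimension over `k` of the image of `R_t` in `R / J`. -/
def hilbertFunction (J : Ideal (MvPolynomial (Fin (r + 1)) k)) (t : ℤ) : ℕ :=
  Module.finrank k ((piece k r t).map (Ideal.Quotient.mkₐ k J).toLinearMap)

/-- The homogeneous part of degree `t` of the graded free module `⨁ i, R(-a i)`. -/
def twistedPiece {m : ℕ} (a : Fin m → ℕ) (t : ℤ) :
    Set (Fin m → MvPolynomial (Fin (r + 1)) k) :=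
  {v | ∀ i, v i ∈ piece k r (t - a i)}

/-- The sequence `0 → ⨁ j, R(-b j) → ⨁ i, R(-a i) → I → 0`, with first map `φ` and second map `ε`,
is a graded free resolution of `I`: it is exact and both maps preserve degrees. -/
structure IsGradedFreeResolution {m n : ℕ} (I : Ideal (MvPolynomial (Fin (r + 1)) k))
    (a : Fin m → ℕ) (b : Fin n → ℕ)
    (φ : (Fin n → MvPolynomial (Fin (r + 1)) k) →ₗ[MvPolynomial (Fin (r + 1)) k]
      (Fin m → MvPolynomial (Fin (r + 1)) k))
    (ε : (Fin m → MvPolynomial (Fin (r + 1)) k) →ₗ[MvPolynomial (Fin (r + 1)) k]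
      MvPolynomial (Fin (r + 1)) k) : Prop where
  injective : Function.Injective φ
  exact : Function.Exact φ ε
  range_eq : LinearMap.range ε = I
  map_degree : ∀ (t : ℤ), ∀ v ∈ twistedPiece b t, φ v ∈ twistedPiece a t
  aug_degree : ∀ (t : ℤ), ∀ v ∈ twistedPiece a t, ε v ∈ piece k r t

/-- A resolution `0 → F₁ → F₀ → I → 0` with first map `φ` is minimal: the image of `φ` lies in
`(x₀, …, x_r) F₀`. -/
def IsMinimal {m n : ℕ}
    (φ : (Fin n → MvPolynomial (Fin (r + 1)) k) →ₗ[MvPolynomial (Fin (r + 1)) k]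
      (Fin m → MvPolynomial (Fin (r + 1)) k)) : Prop :=
  LinearMap.range φ ≤
    irrelevant k r • (⊤ : Submodule (MvPolynomial (Fin (r + 1)) k)
      (Fin m → MvPolynomial (Fin (r + 1)) k))

/-- The signed maximal minor of an `(n + 1) × n` matrix obtained by deleting row `i`. -/
def signedMinor {R : Type*} [CommRing R] {n : ℕ} (M : Matrix (Fin (n + 1)) (Fin n) R)
    (i : Fin (n + 1)) : R :=
  (-1) ^ (i : ℕ) * (M.submatrix i.succAbove id).det

/-- `M` is a Hilbert-Burch matrix of `I`: the sequence `0 → Rⁿ → Rⁿ⁺¹ → I → 0`, whose first map is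
`M` and whose second map is given by the signed maximal minors of `M`, is exact. -/
structure IsHilbertBurchMatrix {R : Type*} [CommRing R] {n : ℕ} (I : Ideal R)
    (M : Matrix (Fin (n + 1)) (Fin n) R) : Prop where
  injective : Function.Injective M.mulVecLin
  exact : Function.Exact M.mulVecLin (Fintype.linearCombination R (signedMinor M))
  span_eq : Ideal.span (Set.range (signedMinor M)) = I

end UnionCI

end

/-! Put `I = I₁ ⊓ I₂`. Everything follows from two identities: `(I : g₂) = I₁`, because `g₂ ∈ I₂` is
a nonzerodivisor modulo `I₁`, and `I + (g₂) = I₂`, because `f₂ - b₂g₂ = a₁f₁ + b₁g₁` lies in `I`.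
They give the exact sequence `0 → R/I₁(-e₂) → R/I → R/I₂ → 0`. The generators and the syzygies are
then read off by cancelling `g₂`, `f₂`, `g₁`, `f₁` in turn (`inf_eq_span`, `unionMatrix_exact`). A
sequence of linear forms regular on both `R/I₁` and `R/I₂` is regular on `R/I`, and the exact
sequence survives reduction modulo it (`RegSeq.of_colon`). Counting dimensions gives the formula for
these particular reductions. It holds for all reductions because the Hilbert function of a reduction
is an iterated difference of that of `R/I`, and the number of differences is forced
(`IsArtinianReduction.hilbertFunction_eq`). The regularity needed comes from heights. A prime
containing `f₁, g₁, g₂` contains `I₁ + I₂`, so it has height at least 3, as there is no common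
component. To pass from heights to regular sequences, start from the variables and exchange elements
one at a time: if `A, u` is regular and `A, v` cuts out dimension zero, then a power of `u` lies in
`(A, v)`, which makes `v` regular modulo `A`. General linear forms `L` keep every intermediate list
zero-dimensional, so regularity passes from the variables to `L` and from `L` to the given forms
(`exists_general_linear_forms`). -/

open MvPolynomial

noncomputable section

namespace UnionCI

/-! ### Regular sequences on quotient rings, in terms of ideals -/

section RegularSequences

variable {R : Type*} [CommRing R]

/-- Multiplication by `y` is injective on `R / W`. -/
def IsRegMod (W : Ideal R) (y : R) : Prop := ∀ b, y * b ∈ W → b ∈ W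

/-- The list `L` is a weakly regular sequence on `R / W`. -/
def RegSeq : Ideal R → List R → Prop
  | _, [] => True
  | W, y :: L => IsRegMod W y ∧ RegSeq (W ⊔ Ideal.span {y}) L

lemma regSeq_append (W : Ideal R) (A B : List R) :
    RegSeq W (A ++ B) ↔ RegSeq W A ∧ RegSeq (W ⊔ Ideal.ofList A) B := by
  induction A generalizing W with
  | nil => simp [RegSeq]
  | cons y A ih =>
    rw [List.cons_append, RegSeq, RegSeq, ih, Ideal.ofList_cons, sup_assoc, and_assoc]

lemma regSeq_iff_getElem (W : Ideal R) (L : List R) :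
    RegSeq W L ↔ ∀ (i : ℕ) (h : i < L.length), IsRegMod (W ⊔ Ideal.ofList (L.take i)) L[i] := by
  induction L generalizing W with
  | nil => simp [RegSeq]
  | cons y L ih =>
    rw [RegSeq, ih]
    constructor
    · rintro ⟨h0, h⟩ i hi
      cases i with
      | zero => simpa using h0
      | succ i =>
        have := h i (by simpa using hi)
        simpa [sup_assoc] using this
    · intro h
      have h0 := h 0 (by simp)
      rw [List.take_zero, Ideal.ofList_nil, sup_bot_eq] at h0
      refine ⟨h0, fun i hi => ?_⟩
      have := h (i + 1) (by simpa using hi)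
      simpa [sup_assoc] using this

/-- `J • ⊤` is the image of `J` in `R / W`, so the iterated quotient is `R / (W + J)`. -/
lemma isSMulRegular_quotient_iff (W J : Ideal R) (y : R) :
    IsSMulRegular ((R ⧸ W) ⧸ (J • ⊤ : Submodule R (R ⧸ W))) y ↔ IsRegMod (W ⊔ J) y := by
  have key : ∀ b : R, Submodule.Quotient.mk (p := (J • ⊤ : Submodule R (R ⧸ W)))
      (Ideal.Quotient.mk W b) = 0 ↔ b ∈ W ⊔ J := by
    intro b
    have hmap : (J • ⊤ : Submodule R (R ⧸ W)) = Submodule.map (Submodule.mkQ W) J := by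
      rw [← Submodule.range_mkQ W, ← Submodule.map_top, ← Submodule.map_smul'']
      simp
    rw [Submodule.Quotient.mk_eq_zero, hmap]
    change Submodule.mkQ W b ∈ _ ↔ _
    rw [← Submodule.mem_comap, Submodule.comap_map_mkQ]
  rw [isSMulRegular_iff_right_eq_zero_of_smul]
  constructor
  · intro h b hb
    rw [← key]
    refine h _ ?_
    rw [← key] at hb
    exact hb
  · intro h x hx
    obtain ⟨x, rfl⟩ := Submodule.Quotient.mk_surjective _ x
    obtain ⟨b, rfl⟩ := Ideal.Quotient.mk_surjective x
    rw [key]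
    refine h b ?_
    rw [← key]
    exact hx

lemma isWeaklyRegular_iff_regSeq (W : Ideal R) (L : List R) :
    RingTheory.Sequence.IsWeaklyRegular (R ⧸ W) L ↔ RegSeq W L := by
  rw [RingTheory.Sequence.isWeaklyRegular_iff, regSeq_iff_getElem]
  simp_rw [isSMulRegular_quotient_iff]

lemma ofList_smul_top_eq_top_iff (W : Ideal R) (L : List R) :
    (⊤ : Submodule R (R ⧸ W)) = Ideal.ofList L • ⊤ ↔ W ⊔ Ideal.ofList L = ⊤ := by
  have hmap : (Ideal.ofList L • ⊤ : Submodule R (R ⧸ W)) =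
      Submodule.map (Submodule.mkQ W) (Ideal.ofList L) := by
    rw [← Submodule.range_mkQ W, ← Submodule.map_top, ← Submodule.map_smul'']
    simp
  rw [hmap, ← Submodule.comap_map_mkQ]
  constructor
  · intro h
    rw [← h, Submodule.comap_top]
  · intro h
    rw [← Submodule.map_comap_eq_of_surjective (Submodule.mkQ_surjective W)
      (Submodule.map (Submodule.mkQ W) (Ideal.ofList L)), h, Submodule.map_top,
      Submodule.range_mkQ]

lemma isRegular_iff_regSeq (W : Ideal R) (L : List R) :
    RingTheory.Sequence.IsRegular (R ⧸ W) L ↔ RegSeq W L ∧ W ⊔ Ideal.ofList L ≠ ⊤ := by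
  rw [RingTheory.Sequence.isRegular_iff, isWeaklyRegular_iff_regSeq, ne_eq, ne_eq,
    ofList_smul_top_eq_top_iff]

/-- If a power of `x` lies in `(W, y)` and `x` is regular modulo `W`, so is `y`. -/
lemma IsRegMod.exchange {W : Ideal R} {x y : R} (hx : IsRegMod W x) {N : ℕ}
    (h : x ^ N ∈ W ⊔ Ideal.span {y}) : IsRegMod W y := by
  intro b hb
  have hpow : ∀ n : ℕ, x ^ n * b ∈ W → b ∈ W := by
    intro n
    induction n with
    | zero => simp
    | succ n ih =>
      intro h
      exact ih (hx _ (by rwa [← mul_assoc, ← pow_succ']))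
  refine hpow N ?_
  obtain ⟨w, hw, z, hz, e⟩ := Submodule.mem_sup.mp h
  obtain ⟨c, rfl⟩ := Ideal.mem_span_singleton'.mp hz
  rw [← e, add_mul, mul_assoc]
  exact W.add_mem (W.mul_mem_right _ hw) (W.mul_mem_left _ hb)

/-- The half of transposing a regular sequence `x, y` that holds in any commutative ring. -/
lemma IsRegMod.swap_right {W : Ideal R} {x y : R} (hx : IsRegMod W x)
    (hy : IsRegMod (W ⊔ Ideal.span {x}) y) : IsRegMod (W ⊔ Ideal.span {y}) x := by
  intro b hb
  obtain ⟨w, hw, z, hz, e⟩ := Submodule.mem_sup.mp hb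
  obtain ⟨c, rfl⟩ := Ideal.mem_span_singleton'.mp hz
  have h1 : c ∈ W ⊔ Ideal.span {x} := by
    refine hy c ?_
    refine Submodule.mem_sup.mpr ⟨-w, W.neg_mem hw, b * x, Ideal.mem_span_singleton'.mpr ⟨b, rfl⟩, ?_⟩
    linear_combination -e
  obtain ⟨w', hw', z', hz', e'⟩ := Submodule.mem_sup.mp h1
  obtain ⟨d, rfl⟩ := Ideal.mem_span_singleton'.mp hz'
  have h2 : b - d * y ∈ W := by
    refine hx _ ?_
    have : x * (b - d * y) = w + w' * y := by linear_combination -e - y * e'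
    rw [this]
    exact W.add_mem hw (W.mul_mem_right _ hw')
  exact Submodule.mem_sup.mpr ⟨_, h2, d * y, Ideal.mem_span_singleton'.mpr ⟨d, rfl⟩, by ring⟩

/-- A regular sequence on `R / (I : g)` and on `R / (I, g)` is regular on `R / I`, and the
relation between the three ideals persists modulo the sequence. -/
lemma RegSeq.of_colon {g : R} (L : List R) : ∀ {I I₁ I₂ : Ideal R},
    (∀ c, c * g ∈ I ↔ c ∈ I₁) → I₂ = I ⊔ Ideal.span {g} → RegSeq I₁ L → RegSeq I₂ L →
    RegSeq I L ∧ (∀ c, c * g ∈ I ⊔ Ideal.ofList L ↔ c ∈ I₁ ⊔ Ideal.ofList L) := by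
  induction L with
  | nil => intro I I₁ I₂ h1 h2 _ _; simpa [RegSeq] using h1
  | cons l L ih =>
    intro I I₁ I₂ h1 h2 hr1 hr2
    have hle : I ≤ I₂ := h2 ▸ le_sup_left
    have hle1 : I ≤ I₁ := fun i hi => (h1 i).mp (I.mul_mem_right _ hi)
    -- If `l * b ∈ I`, then `b = i + c * g` by regularity on `R / I₂`; now `l * c * g ∈ I` puts `l *
    -- c`, hence `c`, in `I₁`.
    have hreg : IsRegMod I l := by
      intro b hb
      obtain ⟨i, hi, z, hz, e⟩ := Submodule.mem_sup.mp (h2 ▸ hr2.1 b (hle hb))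
      obtain ⟨c, rfl⟩ := Ideal.mem_span_singleton'.mp hz
      have : l * c * g ∈ I := by
        have : l * c * g = l * b - l * i := by rw [← e]; ring
        rw [this]
        exact I.sub_mem hb (I.mul_mem_left _ hi)
      rw [← e]
      exact I.add_mem hi ((h1 c).mpr (hr1.1 c ((h1 _).mp this)))
    -- The snake lemma by hand: in `c * g = i + b * l`, regularity of `l` on `R / I₂` gives `b = i'
    -- + d * g`, so `(c - l * d) * g ∈ I`.
    have hcol : ∀ c, c * g ∈ I ⊔ Ideal.span {l} ↔ c ∈ I₁ ⊔ Ideal.span {l} := by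
      intro c
      constructor
      · intro hc
        obtain ⟨i, hi, z, hz, e⟩ := Submodule.mem_sup.mp hc
        obtain ⟨b, rfl⟩ := Ideal.mem_span_singleton'.mp hz
        have hb : b ∈ I₂ := by
          refine hr2.1 b ?_
          have : l * b = c * g - i := by rw [← e]; ring
          rw [this, h2]
          exact Ideal.sub_mem _ (Ideal.mem_sup_right (Ideal.mul_mem_left _ _
            (Ideal.mem_span_singleton_self g))) (Ideal.mem_sup_left hi)
        obtain ⟨i', hi', z', hz', e'⟩ := Submodule.mem_sup.mp (h2 ▸ hb)
        obtain ⟨d, rfl⟩ := Ideal.mem_span_singleton'.mp hz'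
        have : c - l * d ∈ I₁ := by
          rw [← h1]
          have : (c - l * d) * g = i + i' * l := by linear_combination -e - l * e'
          rw [this]
          exact I.add_mem hi (I.mul_mem_right _ hi')
        exact Submodule.mem_sup.mpr ⟨_, this, d * l, Ideal.mem_span_singleton'.mpr ⟨d, rfl⟩,
          by ring⟩
      · intro hc
        obtain ⟨i, hi, z, hz, rfl⟩ := Submodule.mem_sup.mp hc
        obtain ⟨b, rfl⟩ := Ideal.mem_span_singleton'.mp hz
        rw [add_mul]
        refine Submodule.add_mem_sup ((h1 i).mpr hi) (Ideal.mem_span_singleton'.mpr ⟨b * g, by ring⟩)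
    obtain ⟨h3, h4⟩ := ih hcol (I₂ := I₂ ⊔ Ideal.span {l}) (by rw [h2, sup_right_comm]) hr1.2 hr2.2
    exact ⟨⟨hreg, h3⟩, by simpa only [Ideal.ofList_cons, ← sup_assoc] using h4⟩

end RegularSequences

/-! ### Homogeneous ideals and permutation of regular sequences of forms -/

section Graded

variable {σ k : Type*} [Field k]

attribute [local instance] MvPolynomial.gradedAlgebra

/-- `I` is a homogeneous ideal of the polynomial ring. -/
abbrev HomogIdeal (I : Ideal (MvPolynomial σ k)) : Prop :=
  I.IsHomogeneous (homogeneousSubmodule σ k)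

lemma homogIdeal_span {s : Set (MvPolynomial σ k)} (hs : ∀ p ∈ s, ∃ n, p.IsHomogeneous n) :
    HomogIdeal (Ideal.span s) :=
  Ideal.homogeneous_span _ _ fun p hp => (hs p hp).imp fun _ h => h

lemma homogIdeal_ofList {L : List (MvPolynomial σ k)} (hL : ∀ p ∈ L, ∃ n, p.IsHomogeneous n) :
    HomogIdeal (Ideal.ofList L) :=
  homogIdeal_span hL

lemma HomogIdeal.sup {I J : Ideal (MvPolynomial σ k)} (hI : HomogIdeal I) (hJ : HomogIdeal J) :
    HomogIdeal (I ⊔ J) := Ideal.IsHomogeneous.sup hI hJ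

lemma HomogIdeal.inf {I J : Ideal (MvPolynomial σ k)} (hI : HomogIdeal I) (hJ : HomogIdeal J) :
    HomogIdeal (I ⊓ J) := Ideal.IsHomogeneous.inf hI hJ

lemma HomogIdeal.sup_span {I : Ideal (MvPolynomial σ k)} (hI : HomogIdeal I)
    {p : MvPolynomial σ k} {n : ℕ} (hp : p.IsHomogeneous n) : HomogIdeal (I ⊔ Ideal.span {p}) :=
  hI.sup (homogIdeal_span (by rintro q rfl; exact ⟨n, hp⟩))

lemma homogeneousComponent_mul_of_le {p : MvPolynomial σ k} {d n : ℕ} (hp : p.IsHomogeneous d)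
    (hdn : d ≤ n) (c : MvPolynomial σ k) :
    homogeneousComponent n (p * c) = p * homogeneousComponent (n - d) c := by
  have := DirectSum.coe_decompose_mul_of_left_mem_of_le (homogeneousSubmodule σ k) (b := c)
    (show p ∈ homogeneousSubmodule σ k d from hp) hdn
  rw [← decomposition.decompose'_apply, ← decomposition.decompose'_apply]
  exact this

lemma homogeneousComponent_mul_of_lt {p : MvPolynomial σ k} {d n : ℕ} (hp : p.IsHomogeneous d)
    (hdn : n < d) (c : MvPolynomial σ k) :
    homogeneousComponent n (p * c) = 0 := by
  have := DirectSum.coe_decompose_mul_of_left_mem_of_not_le (homogeneousSubmodule σ k) (b := c)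
    (show p ∈ homogeneousSubmodule σ k d from hp) (not_le.mpr hdn)
  rw [← decomposition.decompose'_apply]
  exact this

/-- The half of the transposition that needs the grading. An element killed by `y` modulo `W` lies
in `W + (xⁿ)` for every `n`; since `x` has positive degree, each of its homogeneous components lies
in `W`. -/
lemma IsRegMod.swap_left {W : Ideal (MvPolynomial σ k)} (hW : HomogIdeal W)
    {x y : MvPolynomial σ k} {d : ℕ} (hd : 0 < d) (hxd : x.IsHomogeneous d) (hx : IsRegMod W x)
    (hy : IsRegMod (W ⊔ Ideal.span {x}) y) : IsRegMod W y := by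
  have step : ∀ n : ℕ, ∀ b, y * b ∈ W → ∃ w ∈ W, ∃ c, b = w + x ^ n * c ∧ y * c ∈ W := by
    intro n
    induction n with
    | zero => exact fun b hb => ⟨0, W.zero_mem, b, by simp, hb⟩
    | succ n ih =>
      intro b hb
      obtain ⟨w, hw, c, rfl, hc⟩ := ih b hb
      obtain ⟨w', hw', z, hz, rfl⟩ := Submodule.mem_sup.mp (hy c (Ideal.mem_sup_left hc))
      obtain ⟨e, rfl⟩ := Ideal.mem_span_singleton'.mp hz
      refine ⟨w + x ^ n * w', W.add_mem hw (W.mul_mem_left _ hw'), e, by ring, hx _ ?_⟩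
      have : x * (y * e) = y * (w' + e * x) - y * w' := by ring
      rw [this]
      exact W.sub_mem hc (W.mul_mem_left _ hw')
  intro b hb
  rw [mem_iff_homogeneousComponent_mem hW]
  intro n
  -- With exponent `n + 1`, the multiple of the power of `x` has no component in degree `n`.
  obtain ⟨w, hw, c, rfl, -⟩ := step (n + 1) b hb
  have h0 : homogeneousComponent n (x ^ (n + 1) * c) = 0 :=
    homogeneousComponent_mul_of_lt (hxd.pow (n + 1)) (by nlinarith) c
  rw [map_add, h0, add_zero]
  exact homogeneousComponent_mem_of_mem hW hw n

/-- A form of positive degree. -/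
def IsPosForm (p : MvPolynomial σ k) : Prop := ∃ n : ℕ, 0 < n ∧ p.IsHomogeneous n

/-- Regular sequences of forms of positive degree may be permuted. -/
lemma RegSeq.perm {L L' : List (MvPolynomial σ k)} (hp : L.Perm L')
    (hL : ∀ p ∈ L, IsPosForm p) {W : Ideal (MvPolynomial σ k)} (hW : HomogIdeal W)
    (h : RegSeq W L) : RegSeq W L' := by
  induction hp generalizing W with
  | nil => exact h
  | cons x hp ih =>
    obtain ⟨n, -, hx⟩ := hL x (by simp)
    exact ⟨h.1, ih (fun p hp => hL p (by simp [hp])) (hW.sup_span hx) h.2⟩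
  | swap x y l =>
    obtain ⟨n, hn, hy⟩ := hL y (by simp)
    obtain ⟨h1, h2, h3⟩ := h
    exact ⟨h1.swap_left hW hn hy h2, h1.swap_right h2, by rwa [sup_right_comm]⟩
  | trans h1 h2 ih1 ih2 =>
    exact ih2 (fun p hp => hL p (h1.mem_iff.mpr hp)) hW (ih1 hL hW h)

end Graded

/-! ### Dimension of quotients and cutting by linear forms -/

section Dimension

variable {k : Type*} [Field k] {r : ℕ}

attribute [local instance] MvPolynomial.gradedAlgebra

/-- The ring `R / W` has Krull dimension at most `n`. -/
def DimLE {R : Type*} [CommRing R] (W : Ideal R) (n : ℕ) : Prop :=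
  ∀ P : PrimeSpectrum R, W ≤ P.asIdeal → Order.coheight P ≤ n

lemma mem_irrelevant_iff {p : MvPolynomial (Fin (r + 1)) k} :
    p ∈ irrelevant k r ↔ constantCoeff p = 0 := by
  rw [irrelevant, ← Set.image_univ, mem_ideal_span_X_image, constantCoeff_eq]
  constructor
  · intro h
    by_contra h0
    obtain ⟨i, -, hi⟩ := h 0 (mem_support_iff.mpr h0)
    exact hi rfl
  · intro h m hm
    by_contra! hc
    have : m = 0 := Finsupp.ext fun i => hc i (Set.mem_univ i)
    exact (mem_support_iff.mp hm) (this ▸ h)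

lemma irrelevant_eq_ker :
    irrelevant k r = RingHom.ker (constantCoeff : MvPolynomial (Fin (r + 1)) k →+* k) :=
  Ideal.ext fun _ => mem_irrelevant_iff

instance irrelevant_isMaximal : (irrelevant k r).IsMaximal := by
  rw [irrelevant_eq_ker]
  exact RingHom.ker_isMaximal_of_surjective _ fun a => ⟨C a, constantCoeff_C _ a⟩

lemma IsPosForm.mem_irrelevant {p : MvPolynomial (Fin (r + 1)) k} (hp : IsPosForm p) :
    p ∈ irrelevant k r := by
  obtain ⟨n, hn, h⟩ := hp
  rw [mem_irrelevant_iff, constantCoeff_eq]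
  exact h.coeff_eq_zero (by simpa using hn.ne)

lemma ofList_le_irrelevant {L : List (MvPolynomial (Fin (r + 1)) k)} (hL : ∀ p ∈ L, IsPosForm p) :
    Ideal.ofList L ≤ irrelevant k r :=
  Ideal.span_le.mpr fun p hp => (hL p hp).mem_irrelevant

/-- A proper homogeneous ideal is contained in the irrelevant ideal. -/
lemma HomogIdeal.le_irrelevant {I : Ideal (MvPolynomial (Fin (r + 1)) k)} (hI : HomogIdeal I)
    (htop : I ≠ ⊤) : I ≤ irrelevant k r := by
  intro p hp
  rw [mem_irrelevant_iff]
  by_contra h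
  have h0 := homogeneousComponent_mem_of_mem hI hp 0
  rw [homogeneousComponent_zero] at h0
  rw [constantCoeff_eq] at h
  exact htop (I.eq_top_of_isUnit_mem h0 ((isUnit_iff_ne_zero.mpr h).map C))

lemma DimLE.isMaximal {R : Type*} [CommRing R] {W P : Ideal R} (h : DimLE W 0) (hP : P.IsPrime)
    (hle : W ≤ P) : P.IsMaximal := by
  have := h ⟨P, hP⟩ hle
  rw [Nat.cast_zero, nonpos_iff_eq_zero, Order.coheight_eq_zero, PrimeSpectrum.isMax_iff] at this
  exact this

/-- The only prime ideal above a homogeneous ideal of dimension zero is the irrelevant ideal. -/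
lemma DimLE.eq_irrelevant {W P : Ideal (MvPolynomial (Fin (r + 1)) k)} (h : DimLE W 0)
    (hW : HomogIdeal W) (hP : P.IsPrime) (hle : W ≤ P) : P = irrelevant k r := by
  -- The homogeneous core of `P` is a prime above `W`, hence maximal, so it equals both `P` and the
  -- irrelevant ideal.
  set Q := (P.homogeneousCore (homogeneousSubmodule (Fin (r + 1)) k)).toIdeal with hQ
  have hQP : Q ≤ P := Ideal.toIdeal_homogeneousCore_le _ P
  have hQprime : Q.IsPrime := hP.homogeneousCore
  have hWQ : W ≤ Q := by
    rw [← hW.toIdeal_homogeneousCore_eq_self]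
    exact Ideal.homogeneousCore_mono _ hle
  have hQmax := h.isMaximal hQprime hWQ
  have e1 : Q = P := hQmax.eq_of_le hP.ne_top hQP
  have e2 : Q = irrelevant k r := hQmax.eq_of_le irrelevant_isMaximal.ne_top
    (HomogIdeal.le_irrelevant (HomogeneousIdeal.isHomogeneous _) hQprime.ne_top)
  exact e1.symm.trans e2

lemma DimLE.irrelevant_le_radical {W : Ideal (MvPolynomial (Fin (r + 1)) k)} (h : DimLE W 0)
    (hW : HomogIdeal W) : irrelevant k r ≤ W.radical := by
  rw [Ideal.radical_eq_sInf]
  exact le_sInf fun P hP => (h.eq_irrelevant hW hP.2 hP.1).ge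

lemma DimLE.isArtinianRing {R : Type*} [CommRing R] [IsNoetherianRing R] {W : Ideal R}
    (h : DimLE W 0) : IsArtinianRing (R ⧸ W) := by
  have : Ring.KrullDimLE 0 (R ⧸ W) := by
    rw [Ideal.krullDimLE_zero_quotient_iff_forall_minimalPrimes_isMaximal]
    exact fun J hJ => h.isMaximal hJ.1.1 hJ.1.2
  exact IsNoetherianRing.isArtinianRing_of_krullDimLE_zero

lemma dimLE_zero_of_isArtinianRing {R : Type*} [CommRing R] {W : Ideal R}
    [IsArtinianRing (R ⧸ W)] : DimLE W 0 := by
  intro P hP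
  rw [Nat.cast_zero, nonpos_iff_eq_zero, Order.coheight_eq_zero, PrimeSpectrum.isMax_iff]
  have h : Ring.KrullDimLE 0 (R ⧸ W) := inferInstance
  rw [Ideal.krullDimLE_zero_quotient_iff_forall_minimalPrimes_isMaximal] at h
  obtain ⟨Q, hQ, hle⟩ := Ideal.exists_minimalPrimes_le hP
  rw [← (h Q hQ).eq_of_le P.isPrime.ne_top hle]
  exact h Q hQ

/-- Cutting by an element that avoids the non-maximal minimal primes lowers the dimension. -/
lemma DimLE.cut {R : Type*} [CommRing R] {W : Ideal R} {n : ℕ} (h : DimLE W n) {l : R}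
    (hl : ∀ Q ∈ W.minimalPrimes, ¬ Q.IsMaximal → l ∉ Q) :
    DimLE (W ⊔ Ideal.span {l}) (n - 1) := by
  intro P hP
  have hlP : l ∈ P.asIdeal := hP (Ideal.mem_sup_right (Ideal.mem_span_singleton_self l))
  obtain ⟨Q, hQ, hle⟩ := Ideal.exists_minimalPrimes_le (le_sup_left.trans hP)
  -- If `Q` is maximal then `P = Q` has coheight 0, which is within the bound even when `n - 1`
  -- truncates.
  by_cases hmax : Q.IsMaximal
  · have e := hmax.eq_of_le P.isPrime.ne_top hle
    have : Order.coheight P = 0 := by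
      rw [Order.coheight_eq_zero, PrimeSpectrum.isMax_iff, ← e]
      exact hmax
    rw [this]
    exact zero_le
  · have hlt : (⟨Q, hQ.1.1⟩ : PrimeSpectrum R) < P := by
      refine lt_of_le_of_ne hle fun e => hl Q hQ hmax ?_
      rw [← e] at hlP
      exact hlP
    have h1 := (Order.coheight_add_one_le hlt).trans (h ⟨Q, hQ.1.1⟩ hQ.1.2)
    have h2 : Order.coheight P ≠ ⊤ := by
      intro e
      rw [e] at h1
      simp at h1
    lift Order.coheight P to ℕ using h2 with c
    norm_cast at h1 ⊢
    omega

/-- A linear form avoiding finitely many prime ideals different from the irrelevant ideal. -/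
lemma exists_linear_form_avoiding [Infinite k]
    {S : Set (Ideal (MvPolynomial (Fin (r + 1)) k))} (hS : S.Finite)
    (hprime : ∀ Q ∈ S, Q.IsPrime ∧ ¬ Q.IsMaximal) :
    ∃ l : MvPolynomial (Fin (r + 1)) k, l.IsHomogeneous 1 ∧ ∀ Q ∈ S, l ∉ Q := by
  classical
  let V := homogeneousSubmodule (Fin (r + 1)) k 1
  let f : Ideal (MvPolynomial (Fin (r + 1)) k) → Subspace k V := fun Q =>
    (Q.restrictScalars k).comap V.subtype
  let s : Finset (Subspace k V) := hS.toFinset.image f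
  -- A vector space over an infinite field is not a finite union of proper subspaces; a prime
  -- containing every linear form would be the irrelevant ideal, which is maximal.
  have hs : (⊤ : Subspace k V) ∉ s := by
    intro h
    obtain ⟨Q, hQ, e⟩ := Finset.mem_image.mp h
    have hQS := hS.mem_toFinset.mp hQ
    refine (hprime Q hQS).2 ?_
    have hle : irrelevant k r ≤ Q := by
      refine Ideal.span_le.mpr ?_
      rintro _ ⟨i, rfl⟩
      have : (⟨X i, isHomogeneous_X k i⟩ : V) ∈ f Q := e ▸ Submodule.mem_top
      exact this
    rw [← irrelevant_isMaximal.eq_of_le (hprime Q hQS).1.ne_top hle]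
    infer_instance
  obtain ⟨l, hl⟩ := (Set.ne_univ_iff_exists_notMem _).mp
    (Subspace.biUnion_ne_univ_of_top_notMem hs)
  refine ⟨l, l.2, fun Q hQ hlQ => hl ?_⟩
  exact Set.mem_biUnion (Finset.mem_coe.mpr (Finset.mem_image_of_mem f (hS.mem_toFinset.mpr hQ))) hlQ

/-- Finitely many ideals can be cut down simultaneously by general linear forms. -/
lemma exists_linear_forms_cutting [Infinite k] {ι : Type*} [Finite ι] (t : ℕ) :
    ∀ (W : ι → Ideal (MvPolynomial (Fin (r + 1)) k)) (N : ι → ℕ), (∀ s, DimLE (W s) (N s)) →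
    ∃ L : List (MvPolynomial (Fin (r + 1)) k), L.length = t ∧ (∀ l ∈ L, l.IsHomogeneous 1) ∧
      ∀ s, ∀ j ≤ t, DimLE (W s ⊔ Ideal.ofList (L.take j)) (N s - j) := by
  induction t with
  | zero =>
    intro W N h
    refine ⟨[], rfl, by simp, fun s j hj => ?_⟩
    simpa [Nat.le_zero.mp hj] using h s
  | succ t ih =>
    intro W N h
    obtain ⟨l, hl, hlQ⟩ := exists_linear_form_avoiding
      (S := ⋃ s, {Q ∈ (W s).minimalPrimes | ¬ Q.IsMaximal})
      (Set.finite_iUnion fun s =>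
        ((W s).finite_minimalPrimes_of_isNoetherianRing).subset (Set.sep_subset _ _))
      (by
        intro Q hQ
        obtain ⟨s, hs⟩ := Set.mem_iUnion.mp hQ
        exact ⟨hs.1.1.1, hs.2⟩)
    obtain ⟨L, hlen, hL, hcut⟩ := ih (fun s => W s ⊔ Ideal.span {l}) (fun s => N s - 1)
      (fun s => (h s).cut fun Q hQ hmax => hlQ Q (Set.mem_iUnion.mpr ⟨s, hQ, hmax⟩))
    refine ⟨l :: L, by simp [hlen], by simpa using ⟨hl, hL⟩, fun s j hj => ?_⟩
    cases j with
    | zero => simpa using h s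
    | succ j =>
      have := hcut s j (by omega)
      rw [List.take_succ_cons, Ideal.ofList_cons, ← sup_assoc]
      rwa [Nat.sub_sub, add_comm 1 j] at this

/-- The height and the coheight of a prime add up to at most `dim R = r + 1`. -/
lemma dimLE_of_le_height {W : Ideal (MvPolynomial (Fin (r + 1)) k)} {i : ℕ} (hi : i ≤ r + 1)
    (h : ∀ P : Ideal (MvPolynomial (Fin (r + 1)) k), P.IsPrime → W ≤ P → i ≤ P.height) :
    DimLE W (r + 1 - i) := by
  intro P hP
  have h1 := h P.asIdeal P.isPrime hP
  have hdim : Order.krullDim (PrimeSpectrum (MvPolynomial (Fin (r + 1)) k)) = ((r + 1 : ℕ) : ℕ∞) := by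
    have := MvPolynomial.ringKrullDim_of_isNoetherianRing (R := k) (ι := Fin (r + 1))
    rw [ringKrullDim_eq_zero_of_field, zero_add, Nat.card_fin] at this
    exact this
  rw [Order.krullDim_eq_iSup_height_add_coheight_of_nonempty] at hdim
  have h2 : Order.height P + Order.coheight P ≤ ((r + 1 : ℕ) : ℕ∞) := by
    rw [← WithBot.coe_inj.mp hdim]
    exact le_iSup (fun a => Order.height a + Order.coheight a) P
  rw [PrimeSpectrum.height_eq_orderHeight] at h1
  have h4 : (i : ℕ∞) + Order.coheight P ≤ ((r + 1 : ℕ) : ℕ∞) := (by gcongr : _ ≤ _).trans h2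
  have h5 : Order.coheight P ≠ ⊤ := by
    intro h
    rw [h] at h4
    simp at h4
  lift Order.coheight P to ℕ using h5 with c
  norm_cast at h4 ⊢
  omega

end Dimension

/-! ### From heights to regular sequences by exchange -/

section Parameters

variable {k : Type*} [Field k] {r : ℕ}

attribute [local instance] MvPolynomial.gradedAlgebra

/-- The ideal generated by a set of variables is prime. -/
lemma isPrime_span_X_image (s : Set (Fin (r + 1))) :
    (Ideal.span (X '' s : Set (MvPolynomial (Fin (r + 1)) k))).IsPrime := by
  classical
  set Q := Ideal.span (X '' s : Set (MvPolynomial (Fin (r + 1)) k))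
  let φ : MvPolynomial (Fin (r + 1)) k →ₐ[k] MvPolynomial (Fin (r + 1)) k :=
    aeval fun i => if i ∈ s then 0 else X i
  -- Setting the variables in `s` to zero changes nothing modulo `Q`, so `ker φ ≤ Q`.
  have h1 : (Ideal.Quotient.mkₐ k Q).comp φ = Ideal.Quotient.mkₐ k Q := by
    refine MvPolynomial.algHom_ext fun i => ?_
    by_cases hi : i ∈ s
    · have : Ideal.Quotient.mk Q (X i) = 0 :=
        Ideal.Quotient.eq_zero_iff_mem.mpr (Ideal.subset_span ⟨i, hi, rfl⟩)
      simp [φ, hi, this]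
    · simp [φ, hi]
  have h2 : Q = RingHom.ker φ := by
    apply le_antisymm
    · refine Ideal.span_le.mpr ?_
      rintro _ ⟨i, hi, rfl⟩
      simp [φ, hi]
    · intro p hp
      have h3 := DFunLike.congr_fun h1 p
      rw [AlgHom.comp_apply, (RingHom.mem_ker).mp hp, map_zero] at h3
      exact Ideal.Quotient.eq_zero_iff_mem.mp h3.symm
  rw [h2]
  exact RingHom.ker_isPrime _

lemma X_notMem_span_X_image {s : Set (Fin (r + 1))} {i : Fin (r + 1)} (hi : i ∉ s) :
    (X i : MvPolynomial (Fin (r + 1)) k) ∉ Ideal.span (X '' s) := by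
  rw [mem_ideal_span_X_image]
  intro h
  obtain ⟨j, hj, hne⟩ := h (Finsupp.single i 1) (by simp [support_X])
  rw [Finsupp.single_apply] at hne
  split_ifs at hne with e
  · exact hi (e ▸ hj)
  · exact hne rfl

/-- The list of all variables. -/
def varList (k : Type*) [Field k] (r : ℕ) : List (MvPolynomial (Fin (r + 1)) k) :=
  (List.finRange (r + 1)).map X

lemma length_varList : (varList k r).length = r + 1 := by simp [varList]

lemma ofList_take_varList (i : ℕ) :
    Ideal.ofList ((varList k r).take i) = Ideal.span (X '' {j : Fin (r + 1) | j.val < i}) := by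
  unfold Ideal.ofList
  congr 1
  ext p
  simp only [varList, Set.mem_ofPred_eq, List.mem_take_iff_getElem, Set.mem_image]
  constructor
  · rintro ⟨j, hj, rfl⟩
    simp only [List.length_map, List.length_finRange, lt_inf_iff] at hj
    exact ⟨⟨j, hj.2⟩, hj.1, by simp⟩
  · rintro ⟨j, hj, rfl⟩
    exact ⟨j, by simpa using ⟨hj, Nat.lt_succ_iff.mp j.2⟩, by simp⟩

lemma isPosForm_X (i : Fin (r + 1)) : IsPosForm (X i : MvPolynomial (Fin (r + 1)) k) :=
  ⟨1, one_pos, isHomogeneous_X k i⟩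

lemma regSeq_varList : RegSeq ⊥ (varList k r) := by
  rw [regSeq_iff_getElem]
  intro i hi b hb
  rw [bot_sup_eq, ofList_take_varList] at hb ⊢
  refine ((isPrime_span_X_image _).mem_or_mem hb).resolve_left ?_
  simp only [varList, List.getElem_map, List.getElem_finRange]
  exact X_notMem_span_X_image (by simp)

/-- A list of forms of positive degree whose initial segments cut down the dimension. -/
structure IsParameterList (ys : List (MvPolynomial (Fin (r + 1)) k)) : Prop where
  length_le : ys.length ≤ r + 1
  isPosForm : ∀ p ∈ ys, IsPosForm p
  le_height : ∀ i ≤ ys.length, ∀ P : Ideal (MvPolynomial (Fin (r + 1)) k), P.IsPrime →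
    Ideal.ofList (ys.take i) ≤ P → i ≤ P.height

lemma isParameterList_varList : IsParameterList (varList k r) := by
  refine ⟨length_varList.le, ?_, ?_⟩
  · intro p hp
    obtain ⟨i, -, rfl⟩ := List.mem_map.mp hp
    exact isPosForm_X i
  · intro i hi P hP hle
    rw [length_varList] at hi
    have key : ∀ j ≤ r + 1, (j : ℕ∞) ≤ (Ideal.ofList ((varList k r).take j)).height := by
      intro j
      induction j with
      | zero => simp
      | succ j ih =>
        intro hj
        have h1 := ih (by omega)
        simp only [ofList_take_varList] at h1 ⊢
        have p1 := isPrime_span_X_image (k := k) {m : Fin (r + 1) | m.val < j}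
        have p2 := isPrime_span_X_image (k := k) {m : Fin (r + 1) | m.val < j + 1}
        have hlt : Ideal.span (X '' {m : Fin (r + 1) | m.val < j}) <
            Ideal.span (X '' {m : Fin (r + 1) | m.val < j + 1} :
              Set (MvPolynomial (Fin (r + 1)) k)) := by
          refine lt_of_le_of_ne (Ideal.span_mono (Set.image_mono fun m hm => ?_)) fun e => ?_
          · simp only [Set.mem_ofPred_eq] at hm ⊢
            omega
          · refine X_notMem_span_X_image (k := k) (i := (⟨j, by omega⟩ : Fin (r + 1)))
              (s := {m : Fin (r + 1) | m.val < j}) (by simp) ?_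
            rw [e]
            exact Ideal.subset_span ⟨_, by simp, rfl⟩
        have h2 := Ideal.height_add_one_le_of_lt_of_isPrime hlt
        push_cast
        exact (by gcongr : _ ≤ _).trans h2
    exact (key i hi).trans (Ideal.height_mono hle)

/-- In dimension zero the radical of `(A, v)` contains the irrelevant ideal, so some power of `u`
lies in `(A, v)`. -/
lemma RegSeq.exchange_last {A : List (MvPolynomial (Fin (r + 1)) k)}
    {u v : MvPolynomial (Fin (r + 1)) k} (hA : ∀ p ∈ A, IsPosForm p) (hu : IsPosForm u)
    (hv : IsPosForm v) (hdim : DimLE (Ideal.ofList (A ++ [v])) 0)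
    (h : RegSeq ⊥ (A ++ [u])) : RegSeq ⊥ (A ++ [v]) := by
  have hforms : ∀ p ∈ A ++ [v], ∃ n, p.IsHomogeneous n := by
    intro p hp
    rcases List.mem_append.mp hp with hp | hp
    · exact (hA p hp).imp fun _ h => h.2
    · rw [List.mem_singleton.mp hp]
      exact hv.imp fun _ h => h.2
  rw [regSeq_append] at h ⊢
  refine ⟨h.1, ?_, trivial⟩
  obtain ⟨N, hN⟩ := hdim.irrelevant_le_radical (homogIdeal_ofList hforms) hu.mem_irrelevant
  refine h.2.1.exchange (N := N) ?_
  simpa using hN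

/-- If the mixed sequences cut down to dimension zero, their regularity is equivalent. -/
lemma IsParameterList.regSeq_iff {ys L : List (MvPolynomial (Fin (r + 1)) k)}
    (hys : IsParameterList ys) (hlen : L.length = r + 1) (hL : ∀ l ∈ L, IsPosForm l)
    (hdim : ∀ i ≤ ys.length, DimLE (Ideal.ofList (ys.take i ++ L.take (r + 1 - i))) 0)
    (i : ℕ) (hi : i ≤ ys.length) :
    RegSeq ⊥ (ys.take i ++ L.take (r + 1 - i)) ↔ RegSeq ⊥ L := by
  induction i with
  | zero => simp [← hlen]
  | succ i ih =>
    rw [← ih (by omega)]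
    have hr := hys.length_le
    have e1 : ys.take (i + 1) = ys.take i ++ [ys[i]] := by simp
    have e2 : L.take (r + 1 - i) = L.take (r - i) ++ [L[r - i]] := by
      rw [show r + 1 - i = (r - i) + 1 by omega]
      simp
    have e3 : r + 1 - (i + 1) = r - i := by omega
    have d1 := hdim i (by omega)
    have d2 := hdim (i + 1) hi
    rw [e2, ← List.append_assoc] at d1
    rw [e1, e3] at d2
    rw [e1, e2, e3, ← List.append_assoc]
    have hC : ∀ p ∈ ys.take i ++ L.take (r - i), IsPosForm p := by
      intro p hp
      rcases List.mem_append.mp hp with hp | hp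
      · exact hys.isPosForm p (List.mem_of_mem_take hp)
      · exact hL p (List.mem_of_mem_take hp)
    have hu : IsPosForm ys[i] := hys.isPosForm _ (List.getElem_mem _)
    have hv : IsPosForm L[r - i] := hL _ (List.getElem_mem _)
    -- The lists for `i` and `i + 1` differ by trading `L[r - i]` for `ys[i]`; a permutation puts
    -- both in last place.
    have hperm : (ys.take i ++ [ys[i]] ++ L.take (r - i)).Perm
        (ys.take i ++ L.take (r - i) ++ [ys[i]]) := by
      rw [List.append_assoc, List.append_assoc]
      exact List.Perm.append_left _ List.perm_append_comm
    have d3 : DimLE (Ideal.ofList (ys.take i ++ L.take (r - i) ++ [ys[i]])) 0 := by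
      have : Ideal.ofList (ys.take i ++ L.take (r - i) ++ [ys[i]]) =
          Ideal.ofList (ys.take i ++ [ys[i]] ++ L.take (r - i)) := by
        unfold Ideal.ofList
        simp only [hperm.mem_iff]
      rwa [this]
    have hbot : HomogIdeal (⊥ : Ideal (MvPolynomial (Fin (r + 1)) k)) :=
      Ideal.IsHomogeneous.bot _
    have hCu : ∀ p ∈ ys.take i ++ L.take (r - i) ++ [ys[i]], IsPosForm p := by
      intro p hp
      rcases List.mem_append.mp hp with hp | hp
      · exact hC p hp
      · rwa [List.mem_singleton.mp hp]
    constructor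
    · intro h
      exact (h.perm hperm (fun p hp => hCu p (hperm.mem_iff.mp hp)) hbot).exchange_last hC hu hv d1
    · intro h
      exact (h.exchange_last hC hv hu d3).perm hperm.symm hCu hbot

lemma exists_general_linear_forms_dim [Infinite k] {ι : Type*} [Finite ι]
    (ys : ι → List (MvPolynomial (Fin (r + 1)) k)) (hys : ∀ s, IsParameterList (ys s)) :
    ∃ L : List (MvPolynomial (Fin (r + 1)) k), L.length = r + 1 ∧ (∀ l ∈ L, l.IsHomogeneous 1) ∧
      ∀ s, ∀ i ≤ (ys s).length, DimLE (Ideal.ofList ((ys s).take i ++ L.take (r + 1 - i))) 0 := by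
  -- Every initial segment of every list is cut at once; `min` makes the index type uniform in `s`.
  obtain ⟨L, hlen, hL, h⟩ := exists_linear_forms_cutting (r + 1)
    (fun a : ι × Fin (r + 2) => Ideal.ofList ((ys a.1).take (min a.2.val (ys a.1).length)))
    (fun a => r + 1 - min a.2.val (ys a.1).length)
    (fun a => dimLE_of_le_height ((min_le_right _ _).trans (hys a.1).length_le)
      ((hys a.1).le_height _ (min_le_right _ _)))
  refine ⟨L, hlen, hL, fun s i hi => ?_⟩
  have h1 := (hys s).length_le
  have := h (s, ⟨i, by omega⟩) (r + 1 - i) (by omega)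
  simp only [min_eq_left hi, Nat.sub_self] at this
  rwa [Ideal.ofList_append]

/-- Finitely many parameter lists are completed to regular sequences, with Artinian quotient, by
the same linear forms. -/
theorem exists_general_linear_forms [Infinite k] {ι : Type*} [Finite ι]
    (ys : ι → List (MvPolynomial (Fin (r + 1)) k)) (hys : ∀ s, IsParameterList (ys s)) :
    ∃ L : List (MvPolynomial (Fin (r + 1)) k), L.length = r + 1 ∧ (∀ l ∈ L, l.IsHomogeneous 1) ∧
      ∀ s, ∀ i ≤ (ys s).length, RegSeq ⊥ ((ys s).take i ++ L.take (r + 1 - i)) ∧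
        DimLE (Ideal.ofList ((ys s).take i ++ L.take (r + 1 - i))) 0 := by
  obtain ⟨L, hlen, hL, h⟩ := exists_general_linear_forms_dim
    -- The variables join the family: exchanging all of them for `L` proves `L` regular, and `L` is
    -- then exchanged for initial segments of each `ys s`.
    (fun s : Option ι => s.elim (varList k r) ys)
    (by rintro (_ | s); exacts [isParameterList_varList, hys s])
  have hpos : ∀ l ∈ L, IsPosForm l := fun l hl => ⟨1, one_pos, hL l hl⟩
  have hreg : RegSeq ⊥ L := by
    have h1 := isParameterList_varList.regSeq_iff hlen hpos (h none) (r + 1)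
      length_varList.ge
    rw [← h1, List.take_of_length_le length_varList.le]
    simpa using regSeq_varList
  refine ⟨L, hlen, hL, fun s i hi => ⟨?_, h (some s) i hi⟩⟩
  exact ((hys s).regSeq_iff hlen hpos (h (some s)) i hi).mpr hreg

end Parameters

/-! ### Hilbert functions and independence of the Artinian reduction -/

section Hilbert

variable {k : Type*} [Field k] {r : ℕ}

attribute [local instance] MvPolynomial.gradedAlgebra

lemma piece_natCast (n : ℕ) : piece k r n = homogeneousSubmodule (Fin (r + 1)) k n := by
  simp [piece]

lemma mem_piece_natCast {n : ℕ} {p : MvPolynomial (Fin (r + 1)) k} :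
    p ∈ piece k r n ↔ p.IsHomogeneous n := by
  rw [piece_natCast, mem_homogeneousSubmodule]

lemma piece_of_neg {t : ℤ} (ht : t < 0) : piece k r t = ⊥ := by
  simp [piece, ht]

lemma mul_mem_piece {a b : ℤ} {p q : MvPolynomial (Fin (r + 1)) k} (hp : p ∈ piece k r a)
    (hq : q ∈ piece k r b) : p * q ∈ piece k r (a + b) := by
  rcases lt_or_ge a 0 with ha | ha
  · rw [piece_of_neg ha, Submodule.mem_bot] at hp
    simp [hp]
  rcases lt_or_ge b 0 with hb | hb
  · rw [piece_of_neg hb, Submodule.mem_bot] at hq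
    simp [hq]
  lift a to ℕ using ha
  lift b to ℕ using hb
  rw [← Nat.cast_add]
  rw [mem_piece_natCast] at *
  exact hp.mul hq

instance finiteDimensional_piece (t : ℤ) : FiniteDimensional k (piece k r t) := by
  rcases lt_or_ge t 0 with ht | ht
  · rw [piece_of_neg ht]
    infer_instance
  · lift t to ℕ using ht
    rw [piece_natCast]
    exact Module.Finite.iff_fg.mpr (homogeneousSubmodule_fg _ _ _)

lemma hilbertFunction_of_neg (J : Ideal (MvPolynomial (Fin (r + 1)) k)) {t : ℤ} (ht : t < 0) :
    hilbertFunction J t = 0 := by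
  rw [hilbertFunction, piece_of_neg ht, Submodule.map_bot]
  exact finrank_bot k _

/-- The homogeneous part of degree `t` of `R / J`. -/
abbrev quotientPiece (J : Ideal (MvPolynomial (Fin (r + 1)) k)) (t : ℤ) :
    Submodule k (MvPolynomial (Fin (r + 1)) k ⧸ J) :=
  (piece k r t).map (Ideal.Quotient.mkₐ k J).toLinearMap

/-- A form in `(I, g)` of degree `t` is congruent modulo `I` to a multiple of `g` by a form. -/
lemma exists_form_mul_add {I : Ideal (MvPolynomial (Fin (r + 1)) k)} (hI : HomogIdeal I)
    {g : MvPolynomial (Fin (r + 1)) k} {e : ℕ} (hg : g.IsHomogeneous e) {t : ℤ}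
    {p : MvPolynomial (Fin (r + 1)) k} (hp : p ∈ piece k r t) (hpI : p ∈ I ⊔ Ideal.span {g}) :
    ∃ c ∈ piece k r (t - e), p - g * c ∈ I := by
  rcases lt_or_ge t 0 with ht | ht
  · rw [piece_of_neg ht, Submodule.mem_bot] at hp
    exact ⟨0, Submodule.zero_mem _, by simp [hp]⟩
  lift t to ℕ using ht
  rw [mem_piece_natCast] at hp
  obtain ⟨i, hi, z, hz, h⟩ := Submodule.mem_sup.mp hpI
  obtain ⟨c, rfl⟩ := Ideal.mem_span_singleton'.mp hz
  have h1 : homogeneousComponent t i + homogeneousComponent t (g * c) = p := by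
    rw [← map_add, mul_comm g, h, homogeneousComponent_eq_self hp]
  have h2 := homogeneousComponent_mem_of_mem hI hi t
  rcases le_or_gt e t with het | het
  · rw [homogeneousComponent_mul_of_le hg het] at h1
    refine ⟨homogeneousComponent (t - e) c, ?_, ?_⟩
    · rw [← Nat.cast_sub het, mem_piece_natCast]
      exact homogeneousComponent_isHomogeneous _ _
    · rwa [← h1, add_sub_cancel_right]
  · rw [homogeneousComponent_mul_of_lt hg het, add_zero] at h1
    exact ⟨0, Submodule.zero_mem _, by rwa [mul_zero, sub_zero, ← h1]⟩

/-- The exact sequence `0 → R / (I : g) (-e) → R / I → R / (I, g) → 0` in degree `t`. -/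
theorem hilbertFunction_eq_colon_add {I I₁ : Ideal (MvPolynomial (Fin (r + 1)) k)}
    (hI : HomogIdeal I) {g : MvPolynomial (Fin (r + 1)) k} {e : ℕ} (hg : g.IsHomogeneous e)
    (hcol : ∀ c, c * g ∈ I ↔ c ∈ I₁) (t : ℤ) :
    hilbertFunction I t =
      hilbertFunction I₁ (t - e) + hilbertFunction (I ⊔ Ideal.span {g}) t := by
  let T : (MvPolynomial (Fin (r + 1)) k ⧸ I) →ₗ[k]
      (MvPolynomial (Fin (r + 1)) k ⧸ (I ⊔ Ideal.span {g})) :=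
    (Ideal.Quotient.factorₐ k (le_sup_left : I ≤ I ⊔ Ideal.span {g})).toLinearMap
  have hT : ∀ p, T (Ideal.Quotient.mk I p) = Ideal.Quotient.mk _ p := fun p => rfl
  let S : (MvPolynomial (Fin (r + 1)) k ⧸ I₁) →ₗ[k] (MvPolynomial (Fin (r + 1)) k ⧸ I) :=
    (Submodule.mapQ I₁ I (LinearMap.mulLeft (MvPolynomial (Fin (r + 1)) k) g) (by
      intro c hc
      have := (hcol c).mpr hc
      rwa [mul_comm] at this)).restrictScalars k
  have hS : ∀ p, S (Ideal.Quotient.mk I₁ p) = Ideal.Quotient.mk I (g * p) := fun p => rfl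
  have hSinj : Function.Injective S := by
    rw [← LinearMap.ker_eq_bot, LinearMap.ker_eq_bot']
    intro x hx
    obtain ⟨c, rfl⟩ := Ideal.Quotient.mk_surjective x
    rw [hS, Ideal.Quotient.eq_zero_iff_mem, mul_comm, hcol] at hx
    exact Ideal.Quotient.eq_zero_iff_mem.mpr hx
  have hmapT : (quotientPiece I t).map T = quotientPiece (I ⊔ Ideal.span {g}) t := by
    rw [quotientPiece, ← Submodule.map_comp]
    rfl
  -- Exactness in the middle, degree by degree, with `S` multiplication by `g`.
  have hker : quotientPiece I t ⊓ LinearMap.ker T = (quotientPiece I₁ (t - e)).map S := by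
    ext x
    constructor
    · rintro ⟨⟨p, hp, rfl⟩, hx⟩
      have hpI : p ∈ I ⊔ Ideal.span {g} := Ideal.Quotient.eq_zero_iff_mem.mp hx
      obtain ⟨c, hc, hpc⟩ := exists_form_mul_add hI hg hp hpI
      refine ⟨Ideal.Quotient.mk I₁ c, ⟨c, hc, rfl⟩, ?_⟩
      rw [hS]
      exact ((Ideal.Quotient.mk_eq_mk_iff_sub_mem _ _).mpr hpc).symm
    · rintro ⟨_, ⟨c, hc, rfl⟩, rfl⟩
      refine ⟨⟨g * c, ?_, rfl⟩, ?_⟩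
      · have := mul_mem_piece (mem_piece_natCast.mpr hg) hc
        rwa [add_sub_cancel] at this
      · exact Ideal.Quotient.eq_zero_iff_mem.mpr (Ideal.mem_sup_right
          (Ideal.mul_mem_right _ _ (Ideal.mem_span_singleton_self g)))
  have h1 := LinearMap.finrank_range_add_finrank_ker (T.domRestrict (quotientPiece I t))
  rw [LinearMap.range_domRestrict, hmapT] at h1
  have h2 : Module.finrank k (LinearMap.ker (T.domRestrict (quotientPiece I t))) =
      hilbertFunction I₁ (t - e) := by
    rw [LinearMap.ker_domRestrict,
      (Submodule.equivMapOfInjective _ (quotientPiece I t).injective_subtype _).finrank_eq,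
      Submodule.map_comap_subtype, hker]
    exact (Submodule.equivMapOfInjective S hSinj _).finrank_eq.symm
  rw [h2] at h1
  rw [hilbertFunction, hilbertFunction, ← h1, add_comm]
  rfl

lemma hilbertFunction_zero_pos {J : Ideal (MvPolynomial (Fin (r + 1)) k)} (hJ : J ≠ ⊤) :
    0 < hilbertFunction J 0 := by
  have h1 : Ideal.Quotient.mk J 1 ∈ quotientPiece J 0 :=
    ⟨1, mem_piece_natCast.mpr (isHomogeneous_one _ _), rfl⟩
  have : Nontrivial (quotientPiece J 0) := by
    refine ⟨⟨⟨_, h1⟩, 0, fun h => hJ ?_⟩⟩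
    rw [Ideal.eq_top_iff_one, ← Ideal.Quotient.eq_zero_iff_mem]
    exact congrArg Subtype.val h
  exact Module.finrank_pos

/-- Some power of the irrelevant ideal lies in `J`, so forms of large degree vanish in `R / J`. -/
lemma DimLE.finite_support_hilbertFunction {J : Ideal (MvPolynomial (Fin (r + 1)) k)}
    (h : DimLE J 0) (hJ : HomogIdeal J) : (Function.support (hilbertFunction J)).Finite := by
  obtain ⟨N, hN⟩ := Ideal.exists_pow_le_of_le_radical_of_fg (h.irrelevant_le_radical hJ)
    (IsNoetherian.noetherian _)
  refine (Set.finite_Icc (0 : ℤ) N).subset fun t ht => ?_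
  by_contra hc
  rw [Set.mem_Icc, not_and_or, not_le, not_le] at hc
  refine ht ?_
  rcases hc with hc | hc
  · exact hilbertFunction_of_neg J hc
  · lift t to ℕ using by omega
    have : quotientPiece J t = ⊥ := by
      rw [eq_bot_iff]
      rintro _ ⟨p, hp, rfl⟩
      refine Ideal.Quotient.eq_zero_iff_mem.mpr (hN ?_)
      rw [SetLike.mem_coe, mem_piece_natCast] at hp
      refine (mem_pow_idealOfVars_iff' N p).mpr fun x hx => hp.coeff_eq_zero ?_
      omega
    change Module.finrank k (quotientPiece J t) = 0
    rw [this]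
    exact finrank_bot k _

/-- The first difference of a function on the integers. -/
def diff (H : ℤ → ℤ) (t : ℤ) : ℤ := H t - H (t - 1)

lemma finsum_diff {H : ℤ → ℤ} (hH : (Function.support H).Finite) : ∑ᶠ t, diff H t = 0 := by
  have h2 : (Function.support fun t => H (t - 1)).Finite :=
    (hH.preimage ((Equiv.subRight (1 : ℤ)).injective.injOn) :)
  unfold diff
  rw [finsum_sub_distrib hH h2, sub_eq_zero]
  exact (finsum_comp_equiv (Equiv.subRight (1 : ℤ))).symm

lemma finite_support_diff {H : ℤ → ℤ} (hH : (Function.support H).Finite) :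
    (Function.support (diff H)).Finite := by
  have h2 : (Function.support fun t => H (t - 1)).Finite :=
    (hH.preimage ((Equiv.subRight (1 : ℤ)).injective.injOn) :)
  refine (hH.union h2).subset fun t ht => ?_
  by_contra hc
  simp only [Set.mem_union, Function.mem_support, not_or, not_not] at hc
  exact ht (by simp [diff, hc.1, hc.2])

lemma finite_support_iterate_diff {H : ℤ → ℤ} (hH : (Function.support H).Finite) (n : ℕ) :
    (Function.support (diff^[n] H)).Finite := by
  induction n with
  | zero => exact hH
  | succ n ih =>
    rw [Function.iterate_succ_apply']
    exact finite_support_diff ih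

/-- For a linear form `l` regular on `R / I` one has `(I : l) = I`, so the colon sequence says that
cutting by `l` takes one difference. -/
lemma RegSeq.hilbertFunction_eq (L : List (MvPolynomial (Fin (r + 1)) k)) :
    ∀ {I : Ideal (MvPolynomial (Fin (r + 1)) k)}, HomogIdeal I → (∀ l ∈ L, l.IsHomogeneous 1) →
    RegSeq I L → (fun t => (hilbertFunction (I ⊔ Ideal.ofList L) t : ℤ)) =
      diff^[L.length] fun t => (hilbertFunction I t : ℤ) := by
  induction L with
  | nil => intro I _ _ _; simp
  | cons l L ih =>
    intro I hI hL h
    have hl := hL l (by simp)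
    rw [Ideal.ofList_cons, ← sup_assoc, ih (hI.sup_span hl) (fun p hp => hL p (by simp [hp])) h.2,
      List.length_cons, Function.iterate_succ_apply]
    congr 1
    funext t
    have := hilbertFunction_eq_colon_add hI hl (I₁ := I)
      (fun c => ⟨fun hc => h.1 c (by rwa [mul_comm]), fun hc => I.mul_mem_right _ hc⟩) t
    rw [diff, this]
    push_cast
    ring

/-- The Hilbert function of an Artinian reduction does not depend on the reduction. -/
theorem IsArtinianReduction.hilbertFunction_eq {I J J' : Ideal (MvPolynomial (Fin (r + 1)) k)}
    (hI : HomogIdeal I) (h : IsArtinianReduction I J) (h' : IsArtinianReduction I J') :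
    hilbertFunction J = hilbertFunction J' := by
  -- If `L` were longer than `L'`, its Hilbert function would be a positive iterate of `diff` on a
  -- finitely supported function, so it would sum to zero; but it is nonnegative, and positive at 0.
  have key : ∀ {L L' : List (MvPolynomial (Fin (r + 1)) k)}, (∀ p ∈ L, p.IsHomogeneous 1) →
      (∀ p ∈ L', p.IsHomogeneous 1) → RegSeq I L → RegSeq I L' →
      I ⊔ Ideal.ofList L ≠ ⊤ → DimLE (I ⊔ Ideal.ofList L') 0 → L.length ≤ L'.length := by
    intro L L' hL hL' hr hr' htop hdim
    by_contra! hlt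
    have e := RegSeq.hilbertFunction_eq L hI hL hr
    have e' := RegSeq.hilbertFunction_eq L' hI hL' hr'
    obtain ⟨n, hn⟩ := Nat.exists_eq_add_of_lt hlt
    rw [hn, show L'.length + n + 1 = (n + 1) + L'.length by ring, Function.iterate_add_apply,
      ← e'] at e
    have hhom : HomogIdeal (I ⊔ Ideal.ofList L') :=
      hI.sup (homogIdeal_ofList fun p hp => ⟨1, hL' p hp⟩)
    have hfin : (Function.support fun t => (hilbertFunction (I ⊔ Ideal.ofList L') t : ℤ)).Finite :=
      (hdim.finite_support_hilbertFunction hhom).subset fun t ht h0 => ht (by simp [h0])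
    have hsum : ∑ᶠ t, (hilbertFunction (I ⊔ Ideal.ofList L) t : ℤ) = 0 := by
      rw [show (fun t => (hilbertFunction (I ⊔ Ideal.ofList L) t : ℤ)) = _ from e,
        Function.iterate_succ_apply']
      exact finsum_diff (finite_support_iterate_diff hfin n)
    have hfin2 : (Function.support fun t => (hilbertFunction (I ⊔ Ideal.ofList L) t : ℤ)).Finite := by
      rw [e]
      exact finite_support_iterate_diff hfin _
    have hpos := hilbertFunction_zero_pos htop
    have hle := single_le_finsum (0 : ℤ) hfin2 (fun t => Int.natCast_nonneg _)
    rw [hsum] at hle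
    omega
  obtain ⟨L, hL, hreg, rfl, hart⟩ := h
  obtain ⟨L', hL', hreg', rfl, hart'⟩ := h'
  rw [isRegular_iff_regSeq] at hreg hreg'
  have hlen : L.length = L'.length := le_antisymm
    (key hL hL' hreg.1 hreg'.1 hreg.2 dimLE_zero_of_isArtinianRing)
    (key hL' hL hreg'.1 hreg.1 hreg'.2 dimLE_zero_of_isArtinianRing)
  have e := RegSeq.hilbertFunction_eq L hI hL hreg.1
  rw [hlen, ← RegSeq.hilbertFunction_eq L' hI hL' hreg'.1] at e
  funext t
  exact_mod_cast congrFun e t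

end Hilbert

/-! ### Generators and syzygies of the intersection -/

section Algebra

variable {R : Type*} [CommRing R] {f₁ g₁ f₂ g₂ a₁ b₁ b₂ : R}

lemma mem_inf_colon_iff (hg : IsRegMod (Ideal.span {f₁, g₁}) g₂) (c : R) :
    c * g₂ ∈ Ideal.span {f₁, g₁} ⊓ Ideal.span {f₂, g₂} ↔ c ∈ Ideal.span {f₁, g₁} := by
  constructor
  · exact fun h => hg c (by rw [mul_comm]; exact h.1)
  · exact fun h => ⟨Ideal.mul_mem_right _ _ h,
      Ideal.mul_mem_left _ _ (Ideal.subset_span (by simp))⟩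

lemma sub_mem_inf (hmem : f₂ = a₁ * f₁ + b₁ * g₁ + b₂ * g₂) :
    f₂ - b₂ * g₂ ∈ Ideal.span {f₁, g₁} ⊓ Ideal.span {f₂, g₂} :=
  ⟨Ideal.mem_span_pair.mpr ⟨a₁, b₁, by rw [hmem]; ring⟩,
    Ideal.mem_span_pair.mpr ⟨1, -b₂, by ring⟩⟩

lemma inf_sup_span_eq (hmem : f₂ = a₁ * f₁ + b₁ * g₁ + b₂ * g₂) :
    Ideal.span {f₂, g₂} = Ideal.span {f₁, g₁} ⊓ Ideal.span {f₂, g₂} ⊔ Ideal.span {g₂} := by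
  apply le_antisymm
  · refine Ideal.span_le.mpr ?_
    rintro x (rfl | rfl)
    · refine Submodule.mem_sup.mpr ⟨_, sub_mem_inf hmem, b₂ * g₂,
        Ideal.mem_span_singleton'.mpr ⟨b₂, rfl⟩, by ring⟩
    · exact Ideal.mem_sup_right (Ideal.mem_span_singleton_self _)
  · exact sup_le inf_le_right (Ideal.span_mono (by simp))

/-- Generators of the intersection of two ideals `(f₁, g₁)` and `(f₂, g₂)` with
`f₂ ∈ (f₁, g₁, g₂)`. -/
lemma inf_eq_span (hg : IsRegMod (Ideal.span {f₁, g₁}) g₂)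
    (hmem : f₂ = a₁ * f₁ + b₁ * g₁ + b₂ * g₂) :
    Ideal.span {f₁, g₁} ⊓ Ideal.span {f₂, g₂} =
      Ideal.span {f₂ - b₂ * g₂, g₁ * g₂, f₁ * g₂} := by
  apply le_antisymm
  · rintro x ⟨hx1, hx2⟩
    obtain ⟨u, v, rfl⟩ := Ideal.mem_span_pair.mp hx2
    have h1 : (v + u * b₂) * g₂ ∈ Ideal.span {f₁, g₁} := by
      have : (v + u * b₂) * g₂ = (u * f₂ + v * g₂) - u * (f₂ - b₂ * g₂) := by ring
      rw [this]
      exact Ideal.sub_mem _ hx1 (Ideal.mul_mem_left _ _ (sub_mem_inf hmem).1)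
    obtain ⟨p, q, hpq⟩ := Ideal.mem_span_pair.mp (hg _ (by rwa [mul_comm] at h1))
    refine Submodule.mem_span_triple.mpr ⟨u, q, p, ?_⟩
    simp only [smul_eq_mul]
    linear_combination g₂ * hpq
  · refine Ideal.span_le.mpr ?_
    rintro x (rfl | rfl | rfl)
    · exact sub_mem_inf hmem
    · exact (mem_inf_colon_iff hg _).mpr (Ideal.subset_span (by simp))
    · exact (mem_inf_colon_iff hg _).mpr (Ideal.subset_span (by simp))

lemma mulVec_unionMatrix (v : Fin 2 → R) :
    Matrix.mulVecLin !![-g₂, 0; b₁, f₁; a₁, -g₁] v =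
      ![-g₂ * v 0, b₁ * v 0 + f₁ * v 1, a₁ * v 0 - g₁ * v 1] := by
  ext i
  fin_cases i <;> simp [Matrix.mulVec, dotProduct, Fin.sum_univ_two, sub_eq_add_neg]

lemma unionMatrix_injective (hf₁ : IsRegMod ⊥ f₁) (hg₂ : IsRegMod ⊥ g₂) :
    Function.Injective (Matrix.mulVecLin !![-g₂, 0; b₁, f₁; a₁, -g₁]) := by
  rw [← LinearMap.ker_eq_bot, LinearMap.ker_eq_bot']
  intro v hv
  rw [mulVec_unionMatrix] at hv
  have h0 : g₂ * v 0 = 0 := by simpa using congrFun hv 0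
  have h1 : b₁ * v 0 + f₁ * v 1 = 0 := by simpa using congrFun hv 1
  have e0 : v 0 = 0 := by simpa using hg₂ (v 0) (by simpa using h0)
  rw [e0, mul_zero, zero_add] at h1
  have e1 : v 1 = 0 := by simpa using hf₁ (v 1) (by simpa using h1)
  ext i
  fin_cases i
  · exact e0
  · exact e1

/-- In a syzygy `w`, regularity of `f₂` modulo `g₂` gives `w 0 = u * g₂`. Cancelling `g₂` leaves a
relation between `f₁` and `g₁`, which is a Koszul relation with coefficient `s`. -/
lemma unionMatrix_exact (hg₁ : IsRegMod (Ideal.span {f₁}) g₁) (hf₁ : IsRegMod ⊥ f₁)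
    (hg₂ : IsRegMod ⊥ g₂) (hf₂ : IsRegMod (Ideal.span {g₂}) f₂)
    (hmem : f₂ = a₁ * f₁ + b₁ * g₁ + b₂ * g₂) (w : Fin 3 → R) :
    w 0 * (f₂ - b₂ * g₂) + w 1 * (g₁ * g₂) + w 2 * (f₁ * g₂) = 0 ↔
      w ∈ Set.range (Matrix.mulVecLin !![-g₂, 0; b₁, f₁; a₁, -g₁]) := by
  constructor
  · intro h
    have h1 : w 0 ∈ Ideal.span {g₂} := by
      refine hf₂ _ (Ideal.mem_span_singleton'.mpr ⟨w 0 * b₂ - w 1 * g₁ - w 2 * f₁, ?_⟩)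
      linear_combination -h
    obtain ⟨u, hu⟩ := Ideal.mem_span_singleton'.mp h1
    have h2 : u * (f₂ - b₂ * g₂) + w 1 * g₁ + w 2 * f₁ = 0 := by
      simpa using hg₂ _ (show g₂ * (u * (f₂ - b₂ * g₂) + w 1 * g₁ + w 2 * f₁) ∈ (⊥ : Ideal R) by
        rw [Ideal.mem_bot]
        linear_combination h + (f₂ - b₂ * g₂) * hu)
    have h3 : w 1 + u * b₁ ∈ Ideal.span {f₁} := by
      refine hg₁ _ (Ideal.mem_span_singleton'.mpr ⟨-w 2 - u * a₁, ?_⟩)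
      linear_combination -h2 + u * hmem
    obtain ⟨s, hs⟩ := Ideal.mem_span_singleton'.mp h3
    have h4 : w 2 + u * a₁ + s * g₁ = 0 := by
      simpa using hf₁ _ (show f₁ * (w 2 + u * a₁ + s * g₁) ∈ (⊥ : Ideal R) by
        rw [Ideal.mem_bot]
        linear_combination h2 - u * hmem + g₁ * hs)
    refine ⟨![-u, s], ?_⟩
    rw [mulVec_unionMatrix]
    ext i
    fin_cases i
    · simp only [Fin.zero_eta, Matrix.cons_val_zero]
      linear_combination hu
    · simp only [Fin.mk_one, Matrix.cons_val_zero, Matrix.cons_val_one]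
      linear_combination hs
    · simp only [Fin.reduceFinMk, Matrix.cons_val, Matrix.cons_val_zero, Matrix.cons_val_one]
      linear_combination -h4
  · rintro ⟨v, rfl⟩
    rw [mulVec_unionMatrix]
    simp only [Matrix.cons_val]
    rw [hmem]
    ring

/-- The minors differ from the chosen generators by a common sign, which affects neither the ideal
nor the syzygies. -/
lemma signedMinor_unionMatrix (hmem : f₂ = a₁ * f₁ + b₁ * g₁ + b₂ * g₂) :
    signedMinor !![-g₂, 0; b₁, f₁; a₁, -g₁] =
      ![-(f₂ - b₂ * g₂), -(g₁ * g₂), -(f₁ * g₂)] := by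
  ext i
  fin_cases i
  · simp [signedMinor, Matrix.det_fin_two, hmem]
    ring
  · simp [signedMinor, Matrix.det_fin_two, Fin.succAbove]
    ring
  · simp [signedMinor, Matrix.det_fin_two, Fin.succAbove]
    ring

lemma isHilbertBurchMatrix_union (hg : IsRegMod (Ideal.span {f₁, g₁}) g₂)
    (hg₁ : IsRegMod (Ideal.span {f₁}) g₁) (hf₁ : IsRegMod ⊥ f₁)
    (hg₂ : IsRegMod ⊥ g₂) (hf₂ : IsRegMod (Ideal.span {g₂}) f₂)
    (hmem : f₂ = a₁ * f₁ + b₁ * g₁ + b₂ * g₂) :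
    IsHilbertBurchMatrix (Ideal.span {f₁, g₁} ⊓ Ideal.span {f₂, g₂})
      !![-g₂, 0; b₁, f₁; a₁, -g₁] := by
  refine ⟨unionMatrix_injective hf₁ hg₂, fun w => ?_, ?_⟩
  · rw [← unionMatrix_exact hg₁ hf₁ hg₂ hf₂ hmem w, signedMinor_unionMatrix hmem,
      Fintype.linearCombination_apply, Fin.sum_univ_three, ← neg_eq_zero]
    simp only [Matrix.cons_val, smul_eq_mul]
    ring_nf
  · rw [inf_eq_span hg hmem, signedMinor_unionMatrix hmem]
    simp only [Matrix.range_cons, Matrix.range_empty, Set.union_empty, Set.singleton_union]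
    simp only [Ideal.span_insert, Ideal.span_singleton_neg]

end Algebra

/-! ### Heights of the given ideals, degrees and minimality -/

section Forms

variable {k : Type*} [Field k] {r : ℕ}

attribute [local instance] MvPolynomial.gradedAlgebra

lemma isPosForm_of_isHomogeneous {f : MvPolynomial (Fin (r + 1)) k} {d : ℕ}
    (hf : f.IsHomogeneous d) (h0 : f ≠ 0) (hu : ¬ IsUnit f) : IsPosForm f := by
  refine ⟨d, Nat.pos_of_ne_zero ?_, hf⟩
  rintro rfl
  rw [← totalDegree_zero_iff_isHomogeneous, totalDegree_eq_zero_iff_eq_C] at hf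
  rw [hf] at h0 hu
  exact hu ((isUnit_iff_ne_zero.mpr fun h => h0 (by rw [h, map_zero])).map C)

lemma one_le_height_of_mem {P : Ideal (MvPolynomial (Fin (r + 1)) k)} (hP : P.IsPrime)
    {f : MvPolynomial (Fin (r + 1)) k} (h0 : f ≠ 0) (hf : f ∈ P) : 1 ≤ P.height := by
  have hlt : (⊥ : Ideal (MvPolynomial (Fin (r + 1)) k)) < P :=
    bot_lt_iff_ne_bot.mpr fun h => h0 (by simpa [h] using hf)
  have := Ideal.height_add_one_le_of_lt_of_isPrime hlt
  exact le_add_self.trans this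

/-- If `f = 0`, the ideal is principal and Krull's theorem bounds its height by 1; if `f` is a unit,
the ideal has height `⊤`. -/
lemma ne_zero_of_height_span_pair {f g : MvPolynomial (Fin (r + 1)) k}
    (h : (Ideal.span {f, g}).height = 2) : f ≠ 0 ∧ ¬ IsUnit f := by
  have htop : Ideal.span {f, g} ≠ ⊤ := by
    intro e
    rw [e, Ideal.height_top] at h
    exact absurd h (by decide)
  refine ⟨?_, fun hu => htop (Ideal.eq_top_of_isUnit_mem _ (Ideal.subset_span (by simp)) hu)⟩
  rintro rfl
  have e : Ideal.span {0, g} = Ideal.span {g} := by simp [Ideal.span_insert]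
  rw [e] at h htop
  obtain ⟨P, hP⟩ := Ideal.nonempty_minimalPrimes htop
  have h1 := Ideal.height_le_one_of_isPrincipal_of_mem_minimalPrimes (Ideal.span {g}) P hP
  have h2 := (Ideal.height_mono hP.1.2).trans h1
  rw [h] at h2
  exact absurd h2 (by decide)

lemma height_le_of_span_pair {f g : MvPolynomial (Fin (r + 1)) k}
    (h : (Ideal.span {f, g}).height = 2) {P : Ideal (MvPolynomial (Fin (r + 1)) k)}
    (hle : Ideal.ofList [f, g] ≤ P) : 2 ≤ P.height := by
  have e : Ideal.ofList [f, g] = Ideal.span {f, g} := by simp [Ideal.span_insert]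
  rw [← h]
  exact Ideal.height_mono (e ▸ hle)

lemma isParameterList_pair (hr : 2 ≤ r) {f g : MvPolynomial (Fin (r + 1)) k} (hf : IsPosForm f)
    (hg : IsPosForm g) (hf0 : f ≠ 0) (h : (Ideal.span {f, g}).height = 2) :
    IsParameterList [f, g] := by
  refine ⟨by simp; omega, by simpa using ⟨hf, hg⟩, ?_⟩
  intro i hi P hP hle
  simp only [List.length_cons, List.length_nil] at hi
  interval_cases i
  · simp
  · exact_mod_cast one_le_height_of_mem hP hf0 (hle (Ideal.subset_span (by simp)))
  · exact_mod_cast height_le_of_span_pair h hle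

lemma isParameterList_triple (hr : 2 ≤ r) {f g p : MvPolynomial (Fin (r + 1)) k}
    (hfg : IsParameterList [f, g]) (hp : IsPosForm p)
    (h : ∀ P : Ideal (MvPolynomial (Fin (r + 1)) k), P.IsPrime → f ∈ P → g ∈ P → p ∈ P →
      3 ≤ P.height) :
    IsParameterList [f, g, p] := by
  have hpos := hfg.isPosForm
  refine ⟨by simp; omega, by simpa [hp] using hpos, ?_⟩
  intro i hi P hP hle
  rcases (show i ≤ 2 ∨ i = 3 by simp at hi; omega) with hi | rfl
  · refine hfg.le_height i hi P hP ?_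
    have : [f, g].take i = [f, g, p].take i := by interval_cases i <;> rfl
    rwa [this]
  · exact_mod_cast h P hP (hle (Ideal.subset_span (by simp))) (hle (Ideal.subset_span (by simp)))
      (hle (Ideal.subset_span (by simp)))

/-- A prime of height at most 2 above both ideals would be minimal over each, hence a common
component. -/
lemma three_le_height_of_noCommonComponents {I J P : Ideal (MvPolynomial (Fin (r + 1)) k)}
    (hI : I.height = 2) (hJ : J.height = 2) (h : NoCommonComponents I J) (hP : P.IsPrime)
    (hIP : I ≤ P) (hJP : J ≤ P) : 3 ≤ P.height := by
  by_contra! hlt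
  have h2 : P.height ≤ 2 := Order.le_of_lt_add_one (by norm_num; exact hlt)
  exact Set.disjoint_left.mp h (Ideal.mem_minimalPrimes_of_height_le hIP (h2.trans hI.ge))
    (Ideal.mem_minimalPrimes_of_height_le hJP (h2.trans hJ.ge))

lemma mem_irrelevant_iff_not_isUnit {p : MvPolynomial (Fin (r + 1)) k} {t : ℤ}
    (hp : p ∈ piece k r t) : p ∈ irrelevant k r ↔ ¬ IsUnit p := by
  constructor
  · exact fun h hu => irrelevant_isMaximal.ne_top (Ideal.eq_top_of_isUnit_mem _ h hu)
  · intro hu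
    by_cases h0 : p = 0
    · rw [h0]; exact Ideal.zero_mem _
    rcases lt_or_ge t 0 with ht | ht
    · rw [piece_of_neg ht, Submodule.mem_bot] at hp
      exact absurd hp h0
    lift t to ℕ using ht
    exact (isPosForm_of_isHomogeneous (mem_piece_natCast.mp hp) h0 hu).mem_irrelevant

lemma mem_smul_top_pi_iff {R : Type*} [CommRing R] {n : ℕ} (m : Ideal R) (v : Fin n → R) :
    v ∈ m • (⊤ : Submodule R (Fin n → R)) ↔ ∀ i, v i ∈ m := by
  constructor
  · intro h i
    refine Submodule.smul_induction_on h (fun a ha w _ => ?_) (fun x y hx hy => ?_)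
    · exact Ideal.mul_mem_right _ _ ha
    · exact Ideal.add_mem _ hx hy
  · intro h
    rw [pi_eq_sum_univ v]
    exact Submodule.sum_mem _ fun i _ => Submodule.smul_mem_smul (h i) Submodule.mem_top

/-- Minimality means that all entries lie in the irrelevant ideal. Only `a₁` and `b₁`, seen in the
first column, can fail, and a form fails exactly when it is a unit. -/
lemma isMinimal_unionMatrix_iff {f₁ g₁ g₂ a₁ b₁ : MvPolynomial (Fin (r + 1)) k} {s t : ℤ}
    (hf₁ : IsPosForm f₁) (hg₁ : IsPosForm g₁) (hg₂ : IsPosForm g₂)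
    (ha : a₁ ∈ piece k r s) (hb : b₁ ∈ piece k r t) :
    IsMinimal (Matrix.mulVecLin !![-g₂, 0; b₁, f₁; a₁, -g₁]) ↔ ¬ IsUnit a₁ ∧ ¬ IsUnit b₁ := by
  rw [← mem_irrelevant_iff_not_isUnit ha, ← mem_irrelevant_iff_not_isUnit hb]
  constructor
  · intro h
    have := (mem_smul_top_pi_iff _ _).mp (h ⟨![1, 0], rfl⟩)
    rw [mulVec_unionMatrix] at this
    exact ⟨by simpa using this 2, by simpa using this 1⟩
  · rintro ⟨ha, hb⟩ _ ⟨v, rfl⟩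
    rw [mem_smul_top_pi_iff, mulVec_unionMatrix]
    intro i
    fin_cases i
    · exact Ideal.mul_mem_right _ _ (neg_mem hg₂.mem_irrelevant)
    · exact Ideal.add_mem _ (Ideal.mul_mem_right _ _ hb)
        (Ideal.mul_mem_right _ _ hf₁.mem_irrelevant)
    · exact Ideal.sub_mem _ (Ideal.mul_mem_right _ _ ha)
        (Ideal.mul_mem_right _ _ hg₁.mem_irrelevant)

lemma mul_mem_piece_of_eq {a b c : ℤ} {p q : MvPolynomial (Fin (r + 1)) k}
    (hp : p ∈ piece k r a) (hq : q ∈ piece k r b) (h : a + b = c) : p * q ∈ piece k r c :=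
  h ▸ mul_mem_piece hp hq

lemma isGradedFreeResolution_union {d₁ e₁ d₂ e₂ : ℕ}
    {f₁ g₁ f₂ g₂ a₁ b₁ b₂ : MvPolynomial (Fin (r + 1)) k}
    (df₁ : f₁.IsHomogeneous d₁) (dg₁ : g₁.IsHomogeneous e₁)
    (df₂ : f₂.IsHomogeneous d₂) (dg₂ : g₂.IsHomogeneous e₂)
    (hg : IsRegMod (Ideal.span {f₁, g₁}) g₂)
    (hg₁ : IsRegMod (Ideal.span {f₁}) g₁) (hf₁ : IsRegMod ⊥ f₁)
    (hg₂ : IsRegMod ⊥ g₂) (hf₂ : IsRegMod (Ideal.span {g₂}) f₂)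
    (hmem : f₂ = a₁ * f₁ + b₁ * g₁ + b₂ * g₂)
    (ha₁ : a₁ ∈ piece k r ((d₂ : ℤ) - d₁)) (hb₁ : b₁ ∈ piece k r ((d₂ : ℤ) - e₁))
    (hb₂ : b₂ ∈ piece k r ((d₂ : ℤ) - e₂)) :
    IsGradedFreeResolution (Ideal.span {f₁, g₁} ⊓ Ideal.span {f₂, g₂})
      ![d₂, e₁ + e₂, d₁ + e₂] ![d₂ + e₂, e₁ + e₂ + d₁]
      (Matrix.mulVecLin !![-g₂, 0; b₁, f₁; a₁, -g₁])
      (Fintype.linearCombination (MvPolynomial (Fin (r + 1)) k)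
        ![f₂ - b₂ * g₂, g₁ * g₂, f₁ * g₂]) := by
  have pf₁ := mem_piece_natCast.mpr df₁
  have pg₁ := mem_piece_natCast.mpr dg₁
  have pf₂ := mem_piece_natCast.mpr df₂
  have pg₂ := mem_piece_natCast.mpr dg₂
  refine ⟨unionMatrix_injective hf₁ hg₂, fun w => ?_, ?_, fun t v hv => ?_, fun t v hv => ?_⟩
  · rw [← unionMatrix_exact hg₁ hf₁ hg₂ hf₂ hmem w, Fintype.linearCombination_apply,
      Fin.sum_univ_three]
    simp only [Matrix.cons_val, smul_eq_mul]
  · rw [Fintype.range_linearCombination, inf_eq_span hg hmem]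
    simp only [Matrix.range_cons, Matrix.range_empty, Set.union_empty, Set.singleton_union]
  · rw [mulVec_unionMatrix]
    have h0 := hv 0
    have h1 := hv 1
    simp only [Matrix.cons_val_zero, Matrix.cons_val_one, Nat.cast_add] at h0 h1
    intro i
    fin_cases i
    · exact mul_mem_piece_of_eq (neg_mem pg₂) h0 (by simp; ring)
    · exact add_mem (mul_mem_piece_of_eq hb₁ h0 (by simp; ring))
        (mul_mem_piece_of_eq pf₁ h1 (by simp; ring))
    · exact sub_mem (mul_mem_piece_of_eq ha₁ h0 (by simp; ring))
        (mul_mem_piece_of_eq pg₁ h1 (by simp; ring))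
  · rw [Fintype.linearCombination_apply, Fin.sum_univ_three]
    have h0 := hv 0
    have h1 := hv 1
    have h2 := hv 2
    simp only [Matrix.cons_val, Nat.cast_add] at h0 h1 h2
    simp only [Matrix.cons_val, smul_eq_mul]
    refine add_mem (add_mem ?_ ?_) ?_
    · exact mul_mem_piece_of_eq h0 (sub_mem pf₂ (mul_mem_piece_of_eq hb₂ pg₂ (by ring))) (by ring)
    · exact mul_mem_piece_of_eq h1 (mul_mem_piece pg₁ pg₂) (by ring)
    · exact mul_mem_piece_of_eq h2 (mul_mem_piece pf₁ pg₂) (by ring)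

/-- A regular sequence of linear forms with zero-dimensional quotient gives an Artinian
reduction. -/
lemma isArtinianReduction_of_regSeq {I : Ideal (MvPolynomial (Fin (r + 1)) k)}
    {L : List (MvPolynomial (Fin (r + 1)) k)} (hL : ∀ l ∈ L, l.IsHomogeneous 1)
    (hI : I ≤ irrelevant k r) (hreg : RegSeq I L) (hdim : DimLE (I ⊔ Ideal.ofList L) 0) :
    IsArtinianReduction I (I ⊔ Ideal.ofList L) := by
  refine ⟨L, hL, (isRegular_iff_regSeq _ _).mpr ⟨hreg, fun h => ?_⟩, rfl, hdim.isArtinianRing⟩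
  have hle : I ⊔ Ideal.ofList L ≤ irrelevant k r :=
    sup_le hI (ofList_le_irrelevant fun l hl => ⟨1, one_pos, hL l hl⟩)
  exact irrelevant_isMaximal.ne_top (top_le_iff.mp (h ▸ hle))

/-- A prime above `I₁ ⊓ I₂` contains `I₁` or `I₂`. -/
lemma DimLE.inf {R : Type*} [CommRing R] {I₁ I₂ J : Ideal R} {n : ℕ} (h₁ : DimLE (I₁ ⊔ J) n)
    (h₂ : DimLE (I₂ ⊔ J) n) : DimLE (I₁ ⊓ I₂ ⊔ J) n := by
  intro P hP
  rcases (P.isPrime.inf_le).mp (le_sup_left.trans hP) with h | h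
  · exact h₁ P (sup_le h (le_sup_right.trans hP))
  · exact h₂ P (sup_le h (le_sup_right.trans hP))

end Forms

end UnionCI

end

/-! ### The main theorem -/

theorem mainTheorem5 {k : Type*} [Field k] [IsAlgClosed k] (r : ℕ) (hr : 2 ≤ r)
    (d₁ e₁ d₂ e₂ : ℕ) (f₁ g₁ f₂ g₂ : MvPolynomial (Fin (r + 1)) k)
    (hf₁ : f₁.IsHomogeneous d₁) (hg₁ : g₁.IsHomogeneous e₁)
    (hf₂ : f₂.IsHomogeneous d₂) (hg₂ : g₂.IsHomogeneous e₂)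
    (I₁ I₂ : Ideal (MvPolynomial (Fin (r + 1)) k))
    (hI₁ : I₁ = Ideal.span {f₁, g₁}) (hI₂ : I₂ = Ideal.span {f₂, g₂})
    (hc₁ : I₁.height = 2) (hc₂ : I₂.height = 2)
    (hcomp : UnionCI.NoCommonComponents I₁ I₂)
    (hacm : UnionCI.IsACM (I₁ ⊓ I₂))
    (a₁ b₁ b₂ : MvPolynomial (Fin (r + 1)) k)
    (hmem : f₂ = a₁ * f₁ + b₁ * g₁ + b₂ * g₂) :
    I₁ ⊓ I₂ = Ideal.span {f₂ - b₂ * g₂, g₁ * g₂, f₁ * g₂} ∧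
    UnionCI.IsHilbertBurchMatrix (I₁ ⊓ I₂) !![-g₂, 0; b₁, f₁; a₁, -g₁] ∧
    (a₁ ∈ UnionCI.piece k r ((d₂ : ℤ) - d₁) →
      b₁ ∈ UnionCI.piece k r ((d₂ : ℤ) - e₁) →
      b₂ ∈ UnionCI.piece k r ((d₂ : ℤ) - e₂) →
      UnionCI.IsGradedFreeResolution (I₁ ⊓ I₂)
          ![d₂, e₁ + e₂, d₁ + e₂] ![d₂ + e₂, e₁ + e₂ + d₁]
          (Matrix.mulVecLin !![-g₂, 0; b₁, f₁; a₁, -g₁])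
          (Fintype.linearCombination (MvPolynomial (Fin (r + 1)) k)
            ![f₂ - b₂ * g₂, g₁ * g₂, f₁ * g₂]) ∧
        (UnionCI.IsMinimal
            (Matrix.mulVecLin !![-g₂, 0; b₁, f₁; a₁, -g₁]) ↔ ¬ IsUnit a₁ ∧ ¬ IsUnit b₁)) ∧
    (∃ J, UnionCI.IsArtinianReduction (I₁ ⊓ I₂) J) ∧
    (∃ J₁, UnionCI.IsArtinianReduction I₁ J₁) ∧
    (∃ J₂, UnionCI.IsArtinianReduction I₂ J₂) ∧
    (∀ J J₁ J₂, UnionCI.IsArtinianReduction (I₁ ⊓ I₂) J →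
      UnionCI.IsArtinianReduction I₁ J₁ → UnionCI.IsArtinianReduction I₂ J₂ →
      ∀ t : ℤ, UnionCI.hilbertFunction J t =
        UnionCI.hilbertFunction J₁ (t - e₂) + UnionCI.hilbertFunction J₂ t) := by
  subst hI₁ hI₂
  obtain ⟨f₁0, f₁u⟩ := UnionCI.ne_zero_of_height_span_pair hc₁
  obtain ⟨g₁0, g₁u⟩ := UnionCI.ne_zero_of_height_span_pair (Set.pair_comm f₁ g₁ ▸ hc₁)
  obtain ⟨f₂0, f₂u⟩ := UnionCI.ne_zero_of_height_span_pair hc₂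
  have hc₂' : (Ideal.span {g₂, f₂}).height = 2 := Set.pair_comm f₂ g₂ ▸ hc₂
  obtain ⟨g₂0, g₂u⟩ := UnionCI.ne_zero_of_height_span_pair hc₂'
  have pf₁ := UnionCI.isPosForm_of_isHomogeneous hf₁ f₁0 f₁u
  have pg₁ := UnionCI.isPosForm_of_isHomogeneous hg₁ g₁0 g₁u
  have pf₂ := UnionCI.isPosForm_of_isHomogeneous hf₂ f₂0 f₂u
  have pg₂ := UnionCI.isPosForm_of_isHomogeneous hg₂ g₂0 g₂u
  have par₁ : UnionCI.IsParameterList [f₁, g₁, g₂] := by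
    refine UnionCI.isParameterList_triple hr (UnionCI.isParameterList_pair hr pf₁ pg₁ f₁0 hc₁) pg₂
      fun P hP h1 h2 h3 => UnionCI.three_le_height_of_noCommonComponents hc₁ hc₂ hcomp hP ?_ ?_
    · exact Ideal.span_le.mpr (by rintro x (rfl | rfl) <;> assumption)
    · refine Ideal.span_le.mpr ?_
      rintro x (rfl | rfl)
      · rw [hmem]
        exact P.add_mem (P.add_mem (P.mul_mem_left _ h1) (P.mul_mem_left _ h2))
          (P.mul_mem_left _ h3)
      · exact h3
  have par₂ : UnionCI.IsParameterList [g₂, f₂] :=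
    UnionCI.isParameterList_pair hr pg₂ pf₂ g₂0 hc₂'
  -- In the second list `g₂` precedes `f₂`, since the syzygy computation needs `f₂` regular modulo
  -- `g₂`.
  obtain ⟨L, -, hL, h⟩ := UnionCI.exists_general_linear_forms ![[f₁, g₁, g₂], [g₂, f₂]]
    (by intro s; fin_cases s; exacts [par₁, par₂])
  -- Length 3 makes `g₂` regular modulo `I₁`; length 2 in both lists makes the same `r - 1` linear
  -- forms regular on `R / I₁` and `R / I₂`.
  obtain ⟨r₁, -⟩ := h 0 3 (by simp)
  obtain ⟨r₂, dim₁⟩ := h 0 2 (by simp)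
  obtain ⟨r₃, dim₂⟩ := h 1 2 (by simp)
  simp only [Matrix.cons_val_zero, Matrix.cons_val_one, List.take_succ_cons, List.take_zero,
    List.cons_append, List.nil_append, UnionCI.RegSeq, bot_sup_eq, Ideal.ofList_cons,
    ← sup_assoc] at r₁ r₂ r₃ dim₁ dim₂
  set L' := L.take (r + 1 - 2) with hL'def
  have hL' : ∀ l ∈ L', l.IsHomogeneous 1 := fun l hl => hL l (List.mem_of_mem_take hl)
  have s₁ : Ideal.span {f₁} ⊔ Ideal.span {g₁} = Ideal.span {f₁, g₁} := by
    rw [Ideal.span_insert]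
  have s₂ : Ideal.span {g₂} ⊔ Ideal.span {f₂} = Ideal.span {f₂, g₂} := by
    rw [Ideal.span_insert, sup_comm]
  rw [s₁] at r₁ r₂ dim₁
  rw [s₂] at r₃ dim₂
  obtain ⟨n₁, n₂, n₃, -⟩ := r₁
  obtain ⟨-, -, r₂⟩ := r₂
  obtain ⟨n₄, n₅, r₃⟩ := r₃
  have hom₁ : UnionCI.HomogIdeal (Ideal.span {f₁, g₁}) :=
    UnionCI.homogIdeal_span (by rintro x (rfl | rfl); exacts [⟨_, hf₁⟩, ⟨_, hg₁⟩])
  have hom₂ : UnionCI.HomogIdeal (Ideal.span {f₂, g₂}) :=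
    UnionCI.homogIdeal_span (by rintro x (rfl | rfl); exacts [⟨_, hf₂⟩, ⟨_, hg₂⟩])
  have hom : UnionCI.HomogIdeal (Ideal.span {f₁, g₁} ⊓ Ideal.span {f₂, g₂}) :=
    hom₁.inf hom₂
  have le₁ : Ideal.span {f₁, g₁} ≤ UnionCI.irrelevant k r :=
    Ideal.span_le.mpr (by
      rintro x (rfl | rfl); exacts [pf₁.mem_irrelevant, pg₁.mem_irrelevant])
  have le₂ : Ideal.span {f₂, g₂} ≤ UnionCI.irrelevant k r :=
    Ideal.span_le.mpr (by
      rintro x (rfl | rfl); exacts [pf₂.mem_irrelevant, pg₂.mem_irrelevant])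
  have hsup := UnionCI.inf_sup_span_eq hmem
  obtain ⟨reg, hcol⟩ := UnionCI.RegSeq.of_colon L' (UnionCI.mem_inf_colon_iff n₃) hsup r₂ r₃
  have A := UnionCI.isArtinianReduction_of_regSeq hL' (inf_le_left.trans le₁) reg (dim₁.inf dim₂)
  have A₁ := UnionCI.isArtinianReduction_of_regSeq hL' le₁ r₂ dim₁
  have A₂ := UnionCI.isArtinianReduction_of_regSeq hL' le₂ r₃ dim₂
  refine ⟨UnionCI.inf_eq_span n₃ hmem,
    UnionCI.isHilbertBurchMatrix_union n₃ n₂ n₁ n₄ n₅ hmem,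
    fun ha₁ hb₁ hb₂ => ⟨UnionCI.isGradedFreeResolution_union hf₁ hg₁ hf₂ hg₂ n₃ n₂ n₁ n₄ n₅ hmem
      ha₁ hb₁ hb₂, UnionCI.isMinimal_unionMatrix_iff pf₁ pg₁ pg₂ ha₁ hb₁⟩,
    ⟨_, A⟩, ⟨_, A₁⟩, ⟨_, A₂⟩, fun J J₁ J₂ hJ hJ₁ hJ₂ t => ?_⟩
  -- The given reductions are replaced by those along the common `L'`, where `hcol` supplies the
  -- exact sequence.
  rw [hJ.hilbertFunction_eq hom A, hJ₁.hilbertFunction_eq hom₁ A₁, hJ₂.hilbertFunction_eq hom₂ A₂,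
    UnionCI.hilbertFunction_eq_colon_add
      (hom.sup (UnionCI.homogIdeal_ofList fun p hp => ⟨1, hL' p hp⟩)) hg₂ hcol t,
    sup_right_comm, ← hsup]
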